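/- Let $G=(V,E)$ be a finite simple $d$-regular graph with adjacency matrix $A$, put $L=A-dI$, and let $\pi$ be the uniform distribution on $V$. Let $G^n$ be the $n$-fold Cartesian power of $G$ (so $x^n\sim y^n$ iff $x_i\sim y_i$ for some $i$ and $x_j=y_j$ for all $j\ne i$), with adjacency matrix $A_n$ and uniform distribution $\pi^n$ on $V^n$. Throughout, $f$ denotes a nonnegative function that is not identically zero. For such $f$, $q>1$, write $$\overline{\mathcal E}(f,f^{q-1})=\frac{-\langle Lf,f^{q-1}\rangle_\pi}{\langle f,f^{q-1}\rangle_\pi},\qquad \overline{\mathcal E}_n(f,f^{q-1})=\frac{-\langle (A_n-nd I)f,f^{q-1}\rangle_{\pi^n}}{\langle f,f^{q-1}\rangle_{\pi^n}},\qquad \overline{\rm Ent}(g)=\frac{\mathbb E_\pi[g\ln g]-\mathbb E_\pi[g]\ln\mathbb E_\pi[g]}{\mathbb E_\pi[g]},$$ and, with $\inf\emptyset=+\infty$, $$\hat\Xi_q(\alpha)=\inf_{f:\ \overline{\rm Ent}(f^q)\ge\alpha}\overline{\mathcal E}(f,f^{q-1}),\qquad \hat\Xi^{(n)}_{0,q}(\alpha)=\inf_{f:\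 -\frac1n\ln\pi^n(f>0)\ge\alpha}\tfrac1n\,\overline{\mathcal E}_n(f,f^{q-1}).$$ Let ${\rm conv}\,\hat\Xi_q$ be the lower convex envelope of $\hat\Xi_q$ on $[0,\infty)$. For an induced subgraph $G'$ of $G^n$ with nonempty vertex set $V'$ define its $q$-radius $$\rho_q(G')=\max_{f:V'\to[0,\infty),\,f\neq0}\frac{\sum_{x,y\in V',\,x\sim y}f(x)f(y)^{q-1}}{\sum_{x\in V'}f(x)^q},$$ and let $\Lambda_q(m)=\Lambda^{(n)}_q(m)=\max_{G':|V'|\le m}\rho_q(G')$. For a distribution $Q$ on $V$ let $\mathcal T^{(n)}_\epsilon(Q)$ be the set of $x^n\in V^n$ whose empirical measure $T_{x^n}$ satisfies $|T_{x^n}(a)-Q(a)|\le\epsilon Q(a)$ for all $a\in V$ (for $n=0$ it consists of the empty word). **Theorem.** Let $q>1$. (1) For all integers $n\ge1$ and $1\le m\le|V|^n$, with $\alpha=\ln|V|-\frac1n\ln m$, $$\tfrac1n\Lambda^{(n)}_q(m)=d-\hat\Xi^{(n)}_{0,q}(\alpha)\le d-{\rm conv}\,\hat\Xi_q(\alpha).$$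 (2) This bound is asymptotically tight for exponentially large $m$: let $0\le\beta<\ln|V|$ and let $m_n$ be integers with $1\le m_n\le|V|^n$ and $m_n=e^{n\beta+o(n)}$. Then, as $n\to\infty$, both $\frac1n\Lambda^{(n)}_q(m_n)$ and the upper bound $d-{\rm conv}\,\hat\Xi_q(\ln|V|-\frac1n\ln m_n)$ converge to $d-{\rm conv}\,\hat\Xi_q(\ln|V|-\beta)$. (3) In the situation of (2), for every $\eta>0$ there are distributions $Q,R$ on $V$, a number $\lambda\in[0,1]$ and $\epsilon_0>0$ such that for every $\epsilon\in(0,\epsilon_0)$ the subgraphs $G_n'$ of $G^n$ induced on $V_n'=\mathcal T^{(k)}_\epsilon(Q)\times\mathcal T^{(n-k)}_\epsilon(R)$, $k=\lfloor\lambda n\rfloor$, satisfy: $V'_n\neq\emptyset$ and $|V_n'|\le m_n$ for all sufficiently large $n$, and $\lim_{n\to\infty}\frac1n\rho_q(G_n')$ exists and lies in the interval $[\,d-{\rm conv}\,\hat\Xi_q(\ln|V|-\beta)-\eta,\ d-{\rm conv}\,\hat\Xi_q(\ln|V|-\beta)\,]$. -/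

import Mathlib

open Filter Topology Asymptotics

/-! ### Rayleigh quotients and radii -/

/-- The Rayleigh `q`-quotient `(∑_{x,y} f(x) A_{x,y} f(y)^{q-1}) / ∑_x f(x)^q`, for `q > 1`. -/
noncomputable def rayleighQuot {X : Type*} [Fintype X] (q : ℝ) (A : Matrix X X ℝ)
    (f : X → ℝ) : ℝ :=
  (∑ x, ∑ y, f x * A x y * f y ^ (q - 1)) / ∑ x, f x ^ q

/-- The numerical `q`-radius: the largest Rayleigh `q`-quotient over all nonnegative functions
other than the zero function. -/
noncomputable def qRadius {X : Type*} [Fintype X] (q : ℝ) (A : Matrix X X ℝ) : ℝ :=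
  sSup {r : ℝ | ∃ f : X → ℝ, (∀ x, 0 ≤ f x) ∧ f ≠ 0 ∧ r = rayleighQuot q A f}

open Classical in
/-- The `q`-radius of a finite graph is the `q`-radius of its adjacency matrix. -/
noncomputable def graphRadius {W : Type*} [Fintype W] (q : ℝ) (H : SimpleGraph W) : ℝ :=
  qRadius q (H.adjMatrix ℝ)

/-- The `n`-fold Cartesian power of a graph. -/
def cartPow {V : Type*} (G : SimpleGraph V) (n : ℕ) : SimpleGraph (Fin n → V) where
  Adj x y := ∃ i, G.Adj (x i) (y i) ∧ ∀ j, j ≠ i → x j = y j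
  symm := ⟨fun _ _ ⟨i, h, h'⟩ => ⟨i, h.symm, fun j hj => (h' j hj).symm⟩⟩
  loopless := ⟨fun _ ⟨_, h, _⟩ => G.loopless.irrefl _ h⟩

/-- The Faber–Krahn maximum of order `q` and size `m`: the largest `q`-radius of a subgraph
of the `n`-fold Cartesian power of `G` induced on a nonempty set of at most `m` vertices. -/
noncomputable def faberKrahn {V : Type*} [Fintype V] (G : SimpleGraph V) (q : ℝ) (n m : ℕ) : ℝ :=
  sSup {r : ℝ | ∃ S : Finset (Fin n → V), S.Nonempty ∧ S.card ≤ m ∧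
    r = graphRadius q ((cartPow G n).induce (S : Set (Fin n → V)))}

/-! ### Dirichlet forms and entropies on a finite set `X` with a weight `π` -/

/-- The Dirichlet form `-⟨L f, g⟩_π`. -/
noncomputable def dirichlet {X : Type*} [Fintype X] (L : Matrix X X ℝ) (π : X → ℝ)
    (f g : X → ℝ) : ℝ :=
  -∑ x, ∑ y, L x y * f y * g x * π x

/-- The normalized Dirichlet form. -/
noncomputable def normDirichlet {X : Type*} [Fintype X] (L : Matrix X X ℝ) (π : X → ℝ)
    (f g : X → ℝ) : ℝ :=
  dirichlet L π f g / ∑ x, π x * (f x * g x)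

/-- The normalized entropy `(E[f ln f] - E[f] ln E[f]) / E[f]`. -/
noncomputable def normEnt {X : Type*} [Fintype X] (π : X → ℝ) (f : X → ℝ) : ℝ :=
  ((∑ x, π x * (f x * Real.log (f x))) - (∑ x, π x * f x) * Real.log (∑ x, π x * f x)) /
    ∑ x, π x * f x

open Classical in
/-- The `(0,q)`-entropy `-ln π(f > 0)`; it does not depend on `q`. -/
noncomputable def entZero {X : Type*} [Fintype X] (π : X → ℝ) (f : X → ℝ) : ℝ :=
  -Real.log (∑ x with 0 < f x, π x)

/-- The generator of the product semigroup: `L` acts on one coordinate at a time, and the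
results are summed over the coordinates. -/
noncomputable def prodGenerator {X : Type*} [DecidableEq X] (L : Matrix X X ℝ) (n : ℕ) :
    Matrix (Fin n → X) (Fin n → X) ℝ :=
  fun x y => ∑ k, if ∀ j, j ≠ k → x j = y j then L (x k) (y k) else 0

/-- The product distribution `π^n`. -/
noncomputable def prodWeight {X : Type*} (π : X → ℝ) (n : ℕ) : (Fin n → X) → ℝ :=
  fun x => ∏ i, π (x i)

/-- The scaled log-Sobolev function: the infimum of the normalized Dirichlet form of
`(f, f^{q-1})` over the nonnegative nonzero `f` with normalized entropy of `f^q` at least `α`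
(the infimum over the empty set is `⊤`). -/
noncomputable def logSobolevFun {X : Type*} [Fintype X] (L : Matrix X X ℝ) (π : X → ℝ)
    (q α : ℝ) : EReal :=
  ⨅ f ∈ {f : X → ℝ | (∀ x, 0 ≤ f x) ∧ f ≠ 0 ∧ α ≤ normEnt π (fun x => f x ^ q)},
    ((normDirichlet L π f (fun x => f x ^ (q - 1)) : ℝ) : EReal)

/-- The scaled `n`-dimensional Rényi–Sobolev function with parameters `(0, q)`. -/
noncomputable def renyiSobolevZero {X : Type*} [Fintype X] [DecidableEq X] (L : Matrix X X ℝ)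
    (π : X → ℝ) (q : ℝ) (n : ℕ) (α : ℝ) : EReal :=
  ⨅ f ∈ {f : (Fin n → X) → ℝ | (∀ x, 0 ≤ f x) ∧ f ≠ 0 ∧
      α ≤ 1 / (n : ℝ) * entZero (prodWeight π n) f},
    ((1 / (n : ℝ) * normDirichlet (prodGenerator L n) (prodWeight π n) f
      (fun x => f x ^ (q - 1)) : ℝ) : EReal)

/-- The lower convex envelope of `F : D → [-∞, ∞]`: its value at `a` is the infimum of the
heights `t` such that `(a, t)` lies in the convex hull of the epigraph of `F`. -/
noncomputable def convEnvelope (D : Set ℝ) (F : ℝ → EReal) (a : ℝ) : EReal :=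
  ⨅ t ∈ {t : ℝ | (a, t) ∈ convexHull ℝ {p : ℝ × ℝ | p.1 ∈ D ∧ F p.1 ≤ (p.2 : EReal)}},
    (t : EReal)

/-! ### The objects attached to a `d`-regular graph -/

/-- `L = A - d I`, the negative of the graph Laplacian of a `d`-regular graph. -/
noncomputable def graphGenerator {V : Type*} [DecidableEq V] (G : SimpleGraph V)
    [DecidableRel G.Adj] (d : ℕ) : Matrix V V ℝ :=
  G.adjMatrix ℝ - (d : ℝ) • (1 : Matrix V V ℝ)

/-- The uniform distribution. -/
noncomputable def uniformWeight (V : Type*) [Fintype V] : V → ℝ :=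
  fun _ => 1 / (Fintype.card V : ℝ)

/-- The function `\hat Ξ_q` of the graph. -/
noncomputable def graphXi {V : Type*} [Fintype V] [DecidableEq V] (G : SimpleGraph V)
    [DecidableRel G.Adj] (d : ℕ) (q α : ℝ) : EReal :=
  logSobolevFun (graphGenerator G d) (uniformWeight V) q α

/-- The function `\hat Ξ_{0,q}^{(n)}` of the graph. -/
noncomputable def graphXiZero {V : Type*} [Fintype V] [DecidableEq V] (G : SimpleGraph V)
    [DecidableRel G.Adj] (d : ℕ) (q : ℝ) (n : ℕ) (α : ℝ) : EReal :=
  renyiSobolevZero (graphGenerator G d) (uniformWeight V) q n α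

/-- The lower convex envelope of `\hat Ξ_q`, regarded as a function on `[0, ∞)`. -/
noncomputable def graphXiConv {V : Type*} [Fintype V] [DecidableEq V] (G : SimpleGraph V)
    [DecidableRel G.Adj] (d : ℕ) (q α : ℝ) : EReal :=
  convEnvelope (Set.Ici 0) (graphXi G d q) α

/-! ### Typical sets -/

open Classical in
/-- The `ε`-typical set of a distribution `Q`, for words indexed by a finite type `ι`: the words
whose empirical measure `T` satisfies `|T(a) - Q(a)| ≤ ε Q(a)` for every letter `a`. Both sides
are multiplied by the length `N`, so that the empty word is typical. -/
def typicalSet {V : Type*} (ι : Type*) [Fintype ι] (ε : ℝ) (Q : V → ℝ) : Set (ι → V) :=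
  {x | ∀ a, |((Finset.univ.filter fun i => x i = a).card : ℝ) - (Fintype.card ι : ℝ) * Q a| ≤
    ε * ((Fintype.card ι : ℝ) * Q a)}

open Classical in
/-- The product of the `ε`-typical set of `Q` in the first `k` coordinates with the `ε`-typical
set of `R` in the remaining ones. For `k = 0` and for `k = n` it is a single typical set. -/
noncomputable def typicalProduct {V : Type*} [Fintype V] (ε : ℝ) (Q R : V → ℝ) (n k : ℕ) :
    Finset (Fin n → V) :=
  Finset.univ.filter fun x =>
    (fun i : {i : Fin n // i.val < k} => x i.1) ∈ typicalSet {i : Fin n // i.val < k} ε Q ∧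
    (fun i : {i : Fin n // ¬ i.val < k} => x i.1) ∈ typicalSet {i : Fin n // ¬ i.val < k} ε R

set_option linter.unusedSectionVars false

/-! ### The edge form and the Shannon entropy -/

/-- The form `∑_{x,y} A_{x,y} P(x)^s P(y)^{1-s}`. -/
noncomputable def edgeForm {X : Type*} [Fintype X] (s : ℝ) (A : Matrix X X ℝ) (P : X → ℝ) : ℝ :=
  ∑ x, ∑ y, A x y * (P x ^ s * P y ^ (1 - s))

/-- The Shannon entropy of a distribution on a finite set. -/
noncomputable def shannonEntropy {X : Type*} [Fintype X] (P : X → ℝ) : ℝ :=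
  ∑ x, Real.negMulLog (P x)

/-- Hölder's inequality for weighted geometric means. -/
theorem sum_rpow_mul_rpow_le {ι : Type*} (t : Finset ι) {s : ℝ} (hs0 : 0 < s) (hs1 : s < 1)
    {u v : ι → ℝ} (hu : ∀ i ∈ t, 0 ≤ u i) (hv : ∀ i ∈ t, 0 ≤ v i) :
    ∑ i ∈ t, u i ^ s * v i ^ (1 - s) ≤ (∑ i ∈ t, u i) ^ s * (∑ i ∈ t, v i) ^ (1 - s) := by
  have hc : Real.HolderConjugate (1 / s) (1 / (1 - s)) := by
    rw [Real.holderConjugate_iff]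
    refine ⟨by rw [lt_div_iff₀ hs0]; linarith, by simp⟩
  have h := Real.inner_le_Lp_mul_Lq_of_nonneg t hc
    (fun i hi => Real.rpow_nonneg (hu i hi) s) (fun i hi => Real.rpow_nonneg (hv i hi) (1 - s))
  have h1 : ∀ i ∈ t, (u i ^ s) ^ (1 / s) = u i := fun i hi => by
    rw [one_div, Real.rpow_rpow_inv (hu i hi) hs0.ne']
  have h2 : ∀ i ∈ t, (v i ^ (1 - s)) ^ (1 / (1 - s)) = v i := fun i hi => by
    rw [one_div, Real.rpow_rpow_inv (hv i hi) (by linarith)]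
  rw [Finset.sum_congr rfl h1, Finset.sum_congr rfl h2] at h
  simpa using h

theorem rpow_mul_rpow_one_sub {s c : ℝ} (hc : 0 ≤ c) : c ^ s * c ^ (1 - s) = c := by
  rcases hc.eq_or_lt with rfl | hc
  · rcases eq_or_ne s 0 with rfl | hs
    · simp
    · simp [Real.zero_rpow hs]
  · rw [← Real.rpow_add hc]; simp

theorem mul_rpow_mul_rpow_one_sub {s c u v : ℝ} (hc : 0 ≤ c) (hu : 0 ≤ u) (hv : 0 ≤ v) :
    (c * u) ^ s * (c * v) ^ (1 - s) = c * (u ^ s * v ^ (1 - s)) := by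
  rw [Real.mul_rpow hc hu, Real.mul_rpow hc hv, mul_mul_mul_comm, rpow_mul_rpow_one_sub hc]

section EdgeForm

variable {X : Type*} [Fintype X] {s : ℝ} {A : Matrix X X ℝ}

theorem edgeForm_nonneg (hA : ∀ x y, 0 ≤ A x y) {P : X → ℝ} (hP : ∀ x, 0 ≤ P x) :
    0 ≤ edgeForm s A P :=
  Finset.sum_nonneg fun x _ => Finset.sum_nonneg fun y _ =>
    mul_nonneg (hA x y) (mul_nonneg (Real.rpow_nonneg (hP x) _) (Real.rpow_nonneg (hP y) _))

theorem edgeForm_smul (A : Matrix X X ℝ) {c : ℝ} (hc : 0 ≤ c) {P : X → ℝ} (hP : ∀ x, 0 ≤ P x) :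
    edgeForm s A (fun x => c * P x) = c * edgeForm s A P := by
  simp only [edgeForm, Finset.mul_sum]
  refine Finset.sum_congr rfl fun x _ => Finset.sum_congr rfl fun y _ => ?_
  rw [mul_rpow_mul_rpow_one_sub hc (hP x) (hP y)]; ring

/-- The edge form is superadditive. -/
theorem sum_edgeForm_le (hs0 : 0 < s) (hs1 : s < 1) (hA : ∀ x y, 0 ≤ A x y) {ι : Type*}
    (t : Finset ι) {P : ι → X → ℝ} (hP : ∀ i ∈ t, ∀ x, 0 ≤ P i x) :
    ∑ i ∈ t, edgeForm s A (P i) ≤ edgeForm s A (fun x => ∑ i ∈ t, P i x) := by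
  simp only [edgeForm]
  rw [Finset.sum_comm]
  refine Finset.sum_le_sum fun x _ => ?_
  rw [Finset.sum_comm]
  refine Finset.sum_le_sum fun y _ => ?_
  rw [← Finset.mul_sum]
  exact mul_le_mul_of_nonneg_left (sum_rpow_mul_rpow_le t hs0 hs1 (fun i hi => hP i hi x)
    (fun i hi => hP i hi y)) (hA x y)

theorem edgeForm_mix_le (hs0 : 0 < s) (hs1 : s < 1) (hA : ∀ x y, 0 ≤ A x y) {P Q : X → ℝ}
    (hP : ∀ x, 0 ≤ P x) (hQ : ∀ x, 0 ≤ Q x) {a b : ℝ} (ha : 0 ≤ a) (hb : 0 ≤ b) :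
    a * edgeForm s A P + b * edgeForm s A Q ≤ edgeForm s A (fun x => a * P x + b * Q x) := by
  have h := sum_edgeForm_le (X := X) hs0 hs1 hA (Finset.univ : Finset Bool)
    (P := fun i x => if i then a * P x else b * Q x) (fun i _ x => by
      cases i
      · simpa using mul_nonneg hb (hQ x)
      · simpa using mul_nonneg ha (hP x))
  simpa [edgeForm_smul A ha hP, edgeForm_smul A hb hQ] using h

/-- The total weight of the edges counted by an edge form restricted to pairs `(x, y)` in a set:
a bound by the weights of the two marginals. -/
theorem sum_edge_le {X : Type*} {s : ℝ} {A : Matrix X X ℝ} (hs0 : 0 < s)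
    (hs1 : s < 1) (hA : ∀ x y, 0 ≤ A x y) {P : X → ℝ} (hP : ∀ x, 0 ≤ P x) (t : Finset (X × X)) :
    ∑ p ∈ t, A p.1 p.2 * (P p.1 ^ s * P p.2 ^ (1 - s)) ≤
      (∑ p ∈ t, A p.1 p.2 * P p.1) ^ s * (∑ p ∈ t, A p.1 p.2 * P p.2) ^ (1 - s) := by
  refine le_trans (le_of_eq (Finset.sum_congr rfl fun p _ => ?_))
    (sum_rpow_mul_rpow_le t hs0 hs1 (fun p _ => mul_nonneg (hA _ _) (hP p.1))
      (fun p _ => mul_nonneg (hA _ _) (hP p.2)))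
  rw [mul_rpow_mul_rpow_one_sub (hA _ _) (hP _) (hP _)]

theorem edgeForm_le (hs0 : 0 < s) (hs1 : s < 1) (hA : ∀ x y, 0 ≤ A x y) {D : ℝ}
    (hrow : ∀ x, ∑ y, A x y ≤ D) (hcol : ∀ y, ∑ x, A x y ≤ D) {P : X → ℝ}
    (hP : P ∈ stdSimplex ℝ X) : edgeForm s A P ≤ D := by
  have hP0 := hP.1
  have h := sum_edge_le hs0 hs1 hA hP0 Finset.univ
  rw [Fintype.sum_prod_type, Fintype.sum_prod_type, Fintype.sum_prod_type_right] at h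
  have h1 : ∑ x, ∑ y, A x y * P x ≤ D := by
    calc _ ≤ ∑ x, D * P x := Finset.sum_le_sum fun x _ => by
          rw [← Finset.sum_mul]; exact mul_le_mul_of_nonneg_right (hrow x) (hP0 x)
      _ = D := by rw [← Finset.mul_sum, hP.2, mul_one]
  have h2 : ∑ y, ∑ x, A x y * P y ≤ D := by
    calc _ ≤ ∑ x, D * P x := Finset.sum_le_sum fun x _ => by
          rw [← Finset.sum_mul]; exact mul_le_mul_of_nonneg_right (hcol x) (hP0 x)
      _ = D := by rw [← Finset.mul_sum, hP.2, mul_one]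
  have h10 : 0 ≤ ∑ x, ∑ y, A x y * P x :=
    Finset.sum_nonneg fun x _ => Finset.sum_nonneg fun y _ => mul_nonneg (hA _ _) (hP0 _)
  have h20 : 0 ≤ ∑ y, ∑ x, A x y * P y :=
    Finset.sum_nonneg fun x _ => Finset.sum_nonneg fun y _ => mul_nonneg (hA _ _) (hP0 _)
  refine h.trans ?_
  calc _ ≤ D ^ s * D ^ (1 - s) := mul_le_mul (Real.rpow_le_rpow h10 h1 hs0.le)
        (Real.rpow_le_rpow h20 h2 (by linarith)) (Real.rpow_nonneg h20 _)
        (Real.rpow_nonneg (h10.trans h1) _)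
    _ = D := rpow_mul_rpow_one_sub (h10.trans h1)

theorem continuous_edgeForm (hs0 : 0 < s) (hs1 : s < 1) (A : Matrix X X ℝ) :
    Continuous (edgeForm s A) := by
  unfold edgeForm
  refine continuous_finsetSum _ fun x _ => continuous_finsetSum _ fun y _ => ?_
  refine continuous_const.mul (Continuous.mul ?_ ?_)
  · exact (Real.continuous_rpow_const hs0.le).comp (continuous_apply x)
  · exact (Real.continuous_rpow_const (by linarith)).comp (continuous_apply y)

/-! ### Rayleigh quotients as edge forms -/

/-- The distribution proportional to `f^q`. -/
noncomputable def powDist (q : ℝ) (f : X → ℝ) : X → ℝ := fun x => (∑ z, f z ^ q)⁻¹ * f x ^ q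

theorem sum_rpow_pos {q : ℝ} {f : X → ℝ} (hf : ∀ x, 0 ≤ f x) (hf0 : f ≠ 0) :
    0 < ∑ z, f z ^ q := by
  obtain ⟨x, hx⟩ := Function.ne_iff.1 hf0
  exact Finset.sum_pos' (fun z _ => Real.rpow_nonneg (hf z) q)
    ⟨x, Finset.mem_univ x, Real.rpow_pos_of_pos ((hf x).lt_of_ne (Ne.symm hx)) q⟩

theorem powDist_mem {q : ℝ} {f : X → ℝ} (hf : ∀ x, 0 ≤ f x) (hf0 : f ≠ 0) :
    powDist q f ∈ stdSimplex ℝ X := by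
  refine ⟨fun x => mul_nonneg (inv_nonneg.2 (sum_rpow_pos hf hf0).le)
    (Real.rpow_nonneg (hf x) q), ?_⟩
  simp only [powDist]
  rw [← Finset.mul_sum, inv_mul_cancel₀ (sum_rpow_pos hf hf0).ne']

theorem powDist_pos_iff {q : ℝ} (hq : 1 < q) {f : X → ℝ} (hf : ∀ x, 0 ≤ f x) (hf0 : f ≠ 0)
    (x : X) : 0 < powDist q f x ↔ 0 < f x := by
  have h := inv_pos.2 (sum_rpow_pos (q := q) hf hf0)
  rw [powDist, mul_pos_iff_of_pos_left h]
  constructor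
  · intro h'
    refine (hf x).lt_of_ne fun h0 => ?_
    rw [← h0, Real.zero_rpow (by linarith)] at h'
    exact lt_irrefl _ h'
  · exact fun h' => Real.rpow_pos_of_pos h' q

theorem rayleighQuot_eq {q : ℝ} (hq : 1 < q) (A : Matrix X X ℝ) {f : X → ℝ}
    (hf : ∀ x, 0 ≤ f x) (hf0 : f ≠ 0) :
    rayleighQuot q A f = edgeForm (1 / q) A (powDist q f) := by
  have hq0 : q ≠ 0 := by linarith
  unfold powDist
  rw [edgeForm_smul A (inv_nonneg.2 (sum_rpow_pos hf hf0).le)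
    (fun x => Real.rpow_nonneg (hf x) q), rayleighQuot, div_eq_inv_mul]
  congr 1
  refine Finset.sum_congr rfl fun x _ => Finset.sum_congr rfl fun y _ => ?_
  rw [← Real.rpow_mul (hf x), ← Real.rpow_mul (hf y), mul_one_div_cancel hq0, Real.rpow_one,
    show q * (1 - 1 / q) = q - 1 by field_simp]
  ring

theorem powDist_rpow {q : ℝ} (hq : 1 < q) {P : X → ℝ} (hP : P ∈ stdSimplex ℝ X) :
    powDist q (fun x => P x ^ (1 / q)) = P := by
  have h : ∀ x, (P x ^ (1 / q)) ^ q = P x := fun x => by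
    rw [one_div, Real.rpow_inv_rpow (hP.1 x) (by linarith)]
  funext x
  simp only [powDist, h, hP.2, inv_one, one_mul]

theorem rpow_ne_zero_of_mem {q : ℝ} {P : X → ℝ} (hP : P ∈ stdSimplex ℝ X) :
    (fun x => P x ^ (1 / q)) ≠ 0 := by
  intro h
  have h2 := hP.2
  have : ∀ x, P x = 0 := fun x => by
    have := congrFun h x
    rcases (Real.rpow_eq_zero_iff_of_nonneg (hP.1 x)).1 this with h
    exact h.1
  simp [this] at h2

theorem rayleighQuot_rpow {q : ℝ} (hq : 1 < q) (A : Matrix X X ℝ) {P : X → ℝ}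
    (hP : P ∈ stdSimplex ℝ X) :
    rayleighQuot q A (fun x => P x ^ (1 / q)) = edgeForm (1 / q) A P := by
  rw [rayleighQuot_eq hq A (fun x => Real.rpow_nonneg (hP.1 x) _) (rpow_ne_zero_of_mem hP),
    powDist_rpow hq hP]

/-- The numerical radius is a supremum of edge forms over distributions. -/
theorem qRadius_eq {q : ℝ} (hq : 1 < q) (A : Matrix X X ℝ) :
    qRadius q A = sSup (edgeForm (1 / q) A '' stdSimplex ℝ X) := by
  unfold qRadius
  congr 1
  ext r
  constructor
  · rintro ⟨f, hf, hf0, rfl⟩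
    exact ⟨powDist q f, powDist_mem hf hf0, (rayleighQuot_eq hq A hf hf0).symm⟩
  · rintro ⟨P, hP, rfl⟩
    exact ⟨_, fun x => Real.rpow_nonneg (hP.1 x) _, rpow_ne_zero_of_mem hP,
      (rayleighQuot_rpow hq A hP).symm⟩

theorem bddAbove_edgeForm (hs0 : 0 < s) (hs1 : s < 1) (A : Matrix X X ℝ) :
    BddAbove (edgeForm s A '' stdSimplex ℝ X) :=
  (isCompact_stdSimplex ℝ X).bddAbove_image (continuous_edgeForm hs0 hs1 A).continuousOn

/-! ### Radii of induced subgraphs -/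

theorem sum_coe_eq_sum (S : Finset X) [Fintype (S : Set X)] {g : X → ℝ}
    (hg : ∀ x, x ∉ S → g x = 0) : ∑ x : (S : Set X), g x = ∑ x, g x :=
  (Finset.sum_subtype S (F := inferInstanceAs (Fintype (S : Set X))) (fun _ => Iff.rfl) g).symm.trans
    (Finset.sum_subset (Finset.subset_univ S) fun x _ hx => hg x hx)

/-- Restricting a distribution supported on `S` to the subtype does not change its edge form. -/
theorem edgeForm_restrict (hs0 : 0 < s) (hs1 : s < 1) (A : Matrix X X ℝ) {P : X → ℝ}
    (S : Finset X) [Fintype (S : Set X)] (hS : ∀ x, x ∉ S → P x = 0) :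
    edgeForm s (A.submatrix (Subtype.val : ↥(S : Set X) → X) Subtype.val) (fun x => P x) =
      edgeForm s A P := by
  unfold edgeForm
  rw [← sum_coe_eq_sum S]
  · refine Finset.sum_congr rfl fun x _ => ?_
    rw [← sum_coe_eq_sum S]
    · rfl
    intro y hy
    rw [hS y hy, Real.zero_rpow (by linarith)]; simp
  · intro x hx
    refine Finset.sum_eq_zero fun y _ => ?_
    rw [hS x hx, Real.zero_rpow hs0.ne']; simp

end EdgeForm

section Radius

variable {X : Type*} [Fintype X] {q : ℝ}

theorem one_div_pos_of_one_lt (hq : 1 < q) : 0 < 1 / q := by positivity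

theorem one_div_lt_one_of_one_lt (hq : 1 < q) : 1 / q < 1 := by
  rw [div_lt_one (by linarith)]; exact hq

open Classical in
theorem graphRadius_induce_eq {X : Type*} {q : ℝ} (H : SimpleGraph X) (S : Finset X)
    [Fintype (S : Set X)] : graphRadius q (H.induce (S : Set X)) =
      qRadius q ((H.adjMatrix ℝ).submatrix (Subtype.val : ↥(S : Set X) → X) Subtype.val) := by
  unfold graphRadius
  congr 1

open Classical in
theorem edgeForm_le_graphRadius (hq : 1 < q) (H : SimpleGraph X) (S : Finset X)
    [Fintype (S : Set X)] {P : X → ℝ} (hP : P ∈ stdSimplex ℝ X) (hS : ∀ x, x ∉ S → P x = 0) :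
    edgeForm (1 / q) (H.adjMatrix ℝ) P ≤ graphRadius q (H.induce (S : Set X)) := by
  have h0 := one_div_pos_of_one_lt hq
  have h1 := one_div_lt_one_of_one_lt hq
  rw [graphRadius_induce_eq, qRadius_eq hq]
  refine le_csSup (bddAbove_edgeForm h0 h1 _) ⟨fun x => P x, ⟨fun x => hP.1 x, ?_⟩,
    edgeForm_restrict h0 h1 _ S hS⟩
  exact (sum_coe_eq_sum S hS).trans hP.2

open Classical in
theorem graphRadius_le (hq : 1 < q) (H : SimpleGraph X) {S : Finset X} (hne : S.Nonempty)
    [Fintype (S : Set X)] {B : ℝ}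
    (hB : ∀ P ∈ stdSimplex ℝ X, (∀ x, x ∉ S → P x = 0) →
      edgeForm (1 / q) (H.adjMatrix ℝ) P ≤ B) :
    graphRadius q (H.induce (S : Set X)) ≤ B := by
  have h0 := one_div_pos_of_one_lt hq
  have h1 := one_div_lt_one_of_one_lt hq
  rw [graphRadius_induce_eq, qRadius_eq hq]
  obtain ⟨x₀, hx₀⟩ := hne
  refine csSup_le ⟨_, Pi.single ⟨x₀, hx₀⟩ 1, single_mem_stdSimplex ℝ _, rfl⟩ ?_
  rintro _ ⟨P, hP, rfl⟩
  let P' : X → ℝ := fun x => if h : x ∈ S then P ⟨x, h⟩ else 0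
  have hP'S : ∀ x, x ∉ S → P' x = 0 := fun x hx => by simp [P', hx]
  have hP'P : (fun x : (S : Set X) => P' x) = P := by
    funext ⟨x, hx⟩
    have hx' : x ∈ S := hx
    simp [P', hx']
  have := hB P' ⟨fun x => ?_, ?_⟩ hP'S
  · rw [← edgeForm_restrict h0 h1 _ S hP'S, hP'P] at this
    exact this
  · by_cases hx : x ∈ S
    · simpa [P', hx] using hP.1 ⟨x, hx⟩
    · simp [P', hx]
  · rw [← hP.2, ← hP'P, sum_coe_eq_sum S hP'S]

end Radius

/-! ### Product generators -/

section ProdGenerator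

variable {V : Type*} [Fintype V] [DecidableEq V]

theorem sum_prodGenerator_mul (M : Matrix V V ℝ) (n : ℕ) (x : Fin n → V) (g : (Fin n → V) → ℝ) :
    ∑ y, prodGenerator M n x y * g y =
      ∑ k, ∑ a, M (x k) a * g (Function.update x k a) := by
  simp only [prodGenerator, Finset.sum_mul]
  rw [Finset.sum_comm]
  refine Finset.sum_congr rfl fun k _ => ?_
  simp only [ite_mul, zero_mul]
  rw [← Finset.sum_filter]
  refine Finset.sum_nbij' (fun y => y k) (fun a => Function.update x k a) (by simp)
    (fun a _ => ?_) (fun y hy => ?_) (by simp) (fun y hy => ?_)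
  · simp only [Finset.mem_filter, Finset.mem_univ, true_and]
    intro j hj
    rw [Function.update_of_ne hj]
  all_goals
    have h : Function.update x k (y k) = y := by
      funext j
      by_cases hj : j = k
      · subst hj; simp
      · rw [Function.update_of_ne hj]
        exact (Finset.mem_filter.1 hy).2 j hj
  · exact h
  · rw [h]

theorem adjMatrix_cartPow (G : SimpleGraph V) [DecidableRel G.Adj] (n : ℕ)
    [DecidableRel (cartPow G n).Adj] :
    (cartPow G n).adjMatrix ℝ = prodGenerator (G.adjMatrix ℝ) n := by
  ext x y
  rw [SimpleGraph.adjMatrix_apply, prodGenerator]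
  split_ifs with h
  · obtain ⟨i, hi, hij⟩ := h
    rw [Finset.sum_eq_single i]
    · rw [if_pos hij, SimpleGraph.adjMatrix_apply, if_pos hi]
    · intro k _ hk
      rw [if_neg]
      intro h'
      have := h' i (Ne.symm hk)
      rw [this] at hi
      exact G.loopless.irrefl _ hi
    · simp
  · symm
    refine Finset.sum_eq_zero fun k _ => ?_
    split_ifs with hk
    · rw [SimpleGraph.adjMatrix_apply, if_neg]
      exact fun h' => h ⟨k, h', hk⟩
    · rfl

theorem prodGenerator_nonneg {M : Matrix V V ℝ} (hM : ∀ x y, 0 ≤ M x y) (n : ℕ)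
    (x y : Fin n → V) : 0 ≤ prodGenerator M n x y :=
  Finset.sum_nonneg fun k _ => by
    split_ifs
    · exact hM _ _
    · exact le_rfl

theorem sum_prodGenerator {M : Matrix V V ℝ} {D : ℝ} (hM : ∀ x, ∑ y, M x y = D) (n : ℕ)
    (x : Fin n → V) : ∑ y, prodGenerator M n x y = n * D := by
  have := sum_prodGenerator_mul M n x (fun _ => 1)
  simpa [hM] using this

theorem prodGenerator_comm {M : Matrix V V ℝ} (hM : ∀ x y, M x y = M y x) (n : ℕ)
    (x y : Fin n → V) : prodGenerator M n x y = prodGenerator M n y x := by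
  refine Finset.sum_congr rfl fun k _ => ?_
  rw [hM]
  simp only [eq_comm]

theorem edgeForm_prodGenerator (s : ℝ) (M : Matrix V V ℝ) (n : ℕ) (P : (Fin n → V) → ℝ) :
    edgeForm s (prodGenerator M n) P =
      ∑ k, ∑ x, ∑ a, M (x k) a * (P x ^ s * P (Function.update x k a) ^ (1 - s)) := by
  unfold edgeForm
  rw [Finset.sum_comm (s := Finset.univ (α := Fin n))]
  refine Finset.sum_congr rfl fun x _ => ?_
  exact sum_prodGenerator_mul M n x fun y => P x ^ s * P y ^ (1 - s)

/-- The marginal of a weight on words at the coordinate `k`. -/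
noncomputable def coordMarginal {n : ℕ} (P : (Fin n → V) → ℝ) (k : Fin n) (a : V) : ℝ :=
  ∑ x with x k = a, P x

theorem sum_fiber_update {n : ℕ} (P : (Fin n → V) → ℝ) (k : Fin n) (a b : V) :
    ∑ x with x k = b, P (Function.update x k a) = coordMarginal P k a := by
  refine Finset.sum_nbij' (fun x => Function.update x k a) (fun x => Function.update x k b)
    (by simp) (by simp) ?_ ?_ (by simp)
  all_goals
    intro x hx
    simp only [Finset.mem_filter, Finset.mem_univ, true_and] at hx
    simp [← hx]

theorem edgeForm_le_sum_coordMarginal {s : ℝ} (hs0 : 0 < s) (hs1 : s < 1) {M : Matrix V V ℝ}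
    (hM : ∀ x y, 0 ≤ M x y) {n : ℕ} {P : (Fin n → V) → ℝ} (hP : ∀ x, 0 ≤ P x) :
    edgeForm s (prodGenerator M n) P ≤ ∑ k, edgeForm s M (coordMarginal P k) := by
  rw [edgeForm_prodGenerator]
  refine Finset.sum_le_sum fun k _ => ?_
  rw [← Finset.sum_fiberwise Finset.univ (fun x : Fin n → V => x k), edgeForm]
  refine Finset.sum_le_sum fun b _ => ?_
  rw [Finset.sum_comm]
  refine Finset.sum_le_sum fun a _ => ?_
  have h := sum_rpow_mul_rpow_le (Finset.univ.filter fun x : Fin n → V => x k = b) hs0 hs1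
    (u := P) (v := fun x => P (Function.update x k a)) (fun x _ => hP x) (fun x _ => hP _)
  rw [sum_fiber_update] at h
  refine le_trans (le_of_eq ?_) (mul_le_mul_of_nonneg_left h (hM b a))
  rw [Finset.mul_sum]
  refine Finset.sum_congr rfl fun x hx => ?_
  rw [(Finset.mem_filter.1 hx).2]

/-! ### Product weights -/

/-- The weight of a word under a product of (possibly different) weights on the letters. -/
noncomputable def piWeight {n : ℕ} (p : Fin n → V → ℝ) (x : Fin n → V) : ℝ := ∏ i, p i (x i)

theorem sum_piWeight {n : ℕ} (p : Fin n → V → ℝ) : ∑ x, piWeight p x = ∏ i, ∑ a, p i a :=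
  (Fintype.prod_sum p).symm

theorem piWeight_mem {n : ℕ} {p : Fin n → V → ℝ} (hp : ∀ i, p i ∈ stdSimplex ℝ V) :
    piWeight p ∈ stdSimplex ℝ (Fin n → V) := by
  refine ⟨fun x => Finset.prod_nonneg fun i _ => (hp i).1 _, ?_⟩
  rw [sum_piWeight]
  exact Finset.prod_eq_one fun i _ => (hp i).2

theorem sum_prod_erase_mul {n : ℕ} {p : Fin n → V → ℝ} (hp : ∀ i, p i ∈ stdSimplex ℝ V)
    (k : Fin n) (g : V → ℝ) :
    ∑ x : Fin n → V, (∏ j ∈ Finset.univ.erase k, p j (x j)) * g (x k) = ∑ b, g b := by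
  have h := sum_piWeight (Function.update p k g)
  rw [← Finset.mul_prod_erase _ _ (Finset.mem_univ k), Finset.prod_eq_one, mul_one] at h
  · rw [Function.update_self] at h
    rw [← h]
    refine Finset.sum_congr rfl fun x _ => ?_
    rw [piWeight, ← Finset.mul_prod_erase _ _ (Finset.mem_univ k), Function.update_self, mul_comm]
    congr 1
    refine Finset.prod_congr rfl fun j hj => ?_
    rw [Function.update_of_ne (Finset.ne_of_mem_erase hj)]
  · intro j hj
    rw [Function.update_of_ne (Finset.ne_of_mem_erase hj)]
    exact (hp j).2

theorem edgeForm_piWeight (s : ℝ) (M : Matrix V V ℝ) {n : ℕ} {p : Fin n → V → ℝ}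
    (hp : ∀ i, p i ∈ stdSimplex ℝ V) :
    edgeForm s (prodGenerator M n) (piWeight p) = ∑ k, edgeForm s M (p k) := by
  rw [edgeForm_prodGenerator]
  refine Finset.sum_congr rfl fun k _ => ?_
  rw [edgeForm, ← sum_prod_erase_mul hp k fun b => ∑ a, M b a * (p k b ^ s * p k a ^ (1 - s))]
  refine Finset.sum_congr rfl fun x _ => ?_
  rw [Finset.mul_sum]
  refine Finset.sum_congr rfl fun a _ => ?_
  have h1 : piWeight p x = (∏ j ∈ Finset.univ.erase k, p j (x j)) * p k (x k) := by
    rw [piWeight, ← Finset.mul_prod_erase _ _ (Finset.mem_univ k), mul_comm]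
  have h2 : piWeight p (Function.update x k a) =
      (∏ j ∈ Finset.univ.erase k, p j (x j)) * p k a := by
    rw [piWeight, ← Finset.mul_prod_erase _ _ (Finset.mem_univ k), mul_comm, Function.update_self]
    congr 1
    refine Finset.prod_congr rfl fun j hj => ?_
    rw [Function.update_of_ne (Finset.ne_of_mem_erase hj)]
  rw [h1, h2, mul_rpow_mul_rpow_one_sub (Finset.prod_nonneg fun j _ => (hp j).1 _)
    ((hp k).1 _) ((hp k).1 _)]
  ring

/-! ### The chain rule -/

theorem edgeForm_prodGenerator_succ (s : ℝ) (M : Matrix V V ℝ) (n : ℕ)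
    (P : (Fin (n + 1) → V) → ℝ) :
    edgeForm s (prodGenerator M (n + 1)) P =
      ∑ z : Fin n → V, edgeForm s M (fun a => P (Fin.cons a z)) +
        ∑ a, edgeForm s (prodGenerator M n) (fun z => P (Fin.cons a z)) := by
  have key : ∀ g : (Fin (n + 1) → V) → ℝ, ∑ x, g x = ∑ b, ∑ z : Fin n → V, g (Fin.cons b z) := by
    intro g
    rw [← Equiv.sum_comp (Fin.consEquiv fun _ => V), Fintype.sum_prod_type]
    rfl
  rw [edgeForm_prodGenerator, Fin.sum_univ_succ]
  congr 1
  · rw [key, Finset.sum_comm]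
    refine Finset.sum_congr rfl fun z _ => ?_
    rw [edgeForm]
    refine Finset.sum_congr rfl fun b _ => Finset.sum_congr rfl fun a _ => ?_
    rw [Fin.update_cons_zero, Fin.cons_zero]
  · simp only [edgeForm_prodGenerator]
    refine Eq.trans ?_ Finset.sum_comm
    refine Finset.sum_congr rfl fun k _ => ?_
    rw [key]
    refine Finset.sum_congr rfl fun b _ => ?_
    refine Finset.sum_congr rfl fun z _ => ?_
    refine Finset.sum_congr rfl fun a _ => ?_
    rw [← Fin.cons_update, Fin.cons_succ]

theorem sum_cons (n : ℕ) (g : (Fin (n + 1) → V) → ℝ) :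
    ∑ x, g x = ∑ z : Fin n → V, ∑ b, g (Fin.cons b z) := by
  rw [← Equiv.sum_comp (Fin.consEquiv fun _ => V), Fintype.sum_prod_type_right]
  rfl

theorem sum_negMulLog_mul {X : Type*} [Fintype X] (c : ℝ) {p : X → ℝ}
    (hp : p ∈ stdSimplex ℝ X) :
    ∑ a, Real.negMulLog (c * p a) = Real.negMulLog c + c * shannonEntropy p := by
  simp only [Real.negMulLog_mul, Finset.sum_add_distrib, ← Finset.sum_mul, ← Finset.mul_sum,
    hp.2, shannonEntropy, one_mul]

theorem shannonEntropy_nonneg {X : Type*} [Fintype X] {p : X → ℝ} (hp : p ∈ stdSimplex ℝ X) :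
    0 ≤ shannonEntropy p :=
  Finset.sum_nonneg fun a _ => Real.negMulLog_nonneg (hp.1 a) (mem_Icc_of_mem_stdSimplex hp a).2

theorem continuous_shannonEntropy {X : Type*} [Fintype X] :
    Continuous (shannonEntropy : (X → ℝ) → ℝ) :=
  continuous_finsetSum _ fun x _ => Real.continuous_negMulLog.comp (continuous_apply x)

theorem shannonEntropy_le_log_card {X : Type*} [Fintype X] {p : X → ℝ} (hp : p ∈ stdSimplex ℝ X)
    {S : Finset X} (hS : ∀ x, x ∉ S → p x = 0) : shannonEntropy p ≤ Real.log S.card := by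
  have hsum : ∑ x ∈ S, p x = 1 := by
    rw [← hp.2]; exact Finset.sum_subset (Finset.subset_univ S) fun x _ hx => hS x hx
  have hne : S.Nonempty := by
    rw [Finset.nonempty_iff_ne_empty]; rintro rfl; simp at hsum
  have hm : (0 : ℝ) < S.card := by exact_mod_cast hne.card_pos
  have hent : shannonEntropy p = ∑ x ∈ S, Real.negMulLog (p x) :=
    (Finset.sum_subset (Finset.subset_univ S) fun x _ hx => by simp [hS x hx]).symm
  have hle : ∀ x ∈ S, Real.negMulLog (p x) ≤
      p x * Real.log S.card + ((S.card : ℝ)⁻¹ - p x) := by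
    intro x _
    rcases (hp.1 x).eq_or_lt with h | h
    · rw [← h]; simp
    · have h1 := Real.log_le_sub_one_of_pos (inv_pos.2 (mul_pos h hm))
      rw [Real.log_inv, Real.log_mul h.ne' hm.ne'] at h1
      have h2 := mul_le_mul_of_nonneg_left h1 h.le
      rw [Real.negMulLog]
      have h3 : p x * ((p x * (S.card : ℝ))⁻¹ - 1) = (S.card : ℝ)⁻¹ - p x := by
        field_simp
      rw [h3] at h2
      linarith
  rw [hent]
  refine (Finset.sum_le_sum hle).trans (le_of_eq ?_)
  rw [Finset.sum_add_distrib, ← Finset.sum_mul, Finset.sum_sub_distrib, hsum, Finset.sum_const,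
    nsmul_eq_mul, mul_inv_cancel₀ hm.ne']
  ring

/-- The averaged entropy and edge form of a distribution on words are dominated by a convex
combination of entropies and edge forms of distributions on letters. -/
theorem exists_mem_convex_of_word [Nonempty V] {s : ℝ} (hs0 : 0 < s) (hs1 : s < 1)
    {M : Matrix V V ℝ} (hM : ∀ x y, 0 ≤ M x y) {K : Set (ℝ × ℝ)} (hK : Convex ℝ K)
    (hmem : ∀ p ∈ stdSimplex ℝ V, (shannonEntropy p, edgeForm s M p) ∈ K) (n : ℕ)
    {P : (Fin n → V) → ℝ} (hP : P ∈ stdSimplex ℝ (Fin n → V)) :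
    ∃ z ∈ K, n * z.1 ≤ shannonEntropy P ∧ edgeForm s (prodGenerator M n) P ≤ n * z.2 := by
  obtain ⟨p₀, hp₀⟩ : (stdSimplex ℝ V).Nonempty :=
    ⟨_, single_mem_stdSimplex ℝ (Classical.arbitrary V)⟩
  induction n with
  | zero =>
    refine ⟨_, hmem p₀ hp₀, by simpa using shannonEntropy_nonneg hP, ?_⟩
    rw [edgeForm_prodGenerator]; simp
  | succ n ih =>
    set R : (Fin n → V) → ℝ := fun z => ∑ a, P (Fin.cons a z) with hR
    have hR0 : ∀ z, 0 ≤ R z := fun z => Finset.sum_nonneg fun a _ => hP.1 _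
    have hRs : R ∈ stdSimplex ℝ (Fin n → V) := ⟨hR0, by rw [← hP.2, sum_cons]⟩
    have hc : ∀ z, ∃ p ∈ stdSimplex ℝ V, ∀ a, P (Fin.cons a z) = R z * p a := by
      intro z
      rcases (hR0 z).eq_or_lt with h | h
      · refine ⟨p₀, hp₀, fun a => ?_⟩
        rw [← h, zero_mul]
        exact (Finset.sum_eq_zero_iff_of_nonneg fun a _ => hP.1 _).1 h.symm a (Finset.mem_univ a)
      · refine ⟨fun a => (R z)⁻¹ * P (Fin.cons a z), ⟨fun a => mul_nonneg (inv_nonneg.2 h.le)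
          (hP.1 _), ?_⟩, fun a => ?_⟩
        · rw [← Finset.mul_sum, inv_mul_cancel₀ h.ne']
        · rw [mul_inv_cancel_left₀ h.ne']
    choose c hc hPc using hc
    obtain ⟨⟨h, t⟩, hz, hzh, hzt⟩ := ih hRs
    have hw : ∑ z, R z • ((shannonEntropy (c z), edgeForm s M (c z)) : ℝ × ℝ) ∈ K :=
      hK.sum_mem (fun z _ => hR0 z) hRs.2 fun z _ => hmem _ (hc z)
    have hn : (0 : ℝ) < n + 1 := by positivity
    have hmix := hK hz hw (a := n / (n + 1)) (b := 1 / (n + 1)) (by positivity) (by positivity)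
      (by field_simp)
    refine ⟨_, hmix, ?_, ?_⟩
    · have hent : shannonEntropy P = shannonEntropy R + ∑ z, R z * shannonEntropy (c z) := by
        rw [shannonEntropy, sum_cons, shannonEntropy, ← Finset.sum_add_distrib]
        refine Finset.sum_congr rfl fun z _ => ?_
        simp only [hPc]
        exact sum_negMulLog_mul _ (hc z)
      rw [hent]
      simp only [Prod.fst_add, Prod.smul_fst, Prod.fst_sum, smul_eq_mul, Nat.cast_add,
        Nat.cast_one] at hzh ⊢
      have : ((n : ℝ) + 1) * (n / (n + 1) * h + 1 / (n + 1) * ∑ z, R z * shannonEntropy (c z)) =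
          n * h + ∑ z, R z * shannonEntropy (c z) := by field_simp
      rw [this]; linarith
    · have h1 : ∑ z, edgeForm s M (fun a => P (Fin.cons a z)) =
          ∑ z, R z * edgeForm s M (c z) := by
        refine Finset.sum_congr rfl fun z _ => ?_
        simp only [hPc]
        exact edgeForm_smul M (hR0 z) (hc z).1
      have h2 := sum_edgeForm_le hs0 hs1 (prodGenerator_nonneg hM n) (Finset.univ : Finset V)
        (P := fun a z => P (Fin.cons a z)) fun a _ z => hP.1 _
      rw [edgeForm_prodGenerator_succ, h1]
      simp only [Prod.snd_add, Prod.smul_snd, Prod.snd_sum, smul_eq_mul, Nat.cast_add,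
        Nat.cast_one] at hzt ⊢
      have : ((n : ℝ) + 1) * (n / (n + 1) * t + 1 / (n + 1) * ∑ z, R z * edgeForm s M (c z)) =
          n * t + ∑ z, R z * edgeForm s M (c z) := by field_simp
      rw [this]
      have h3 : edgeForm s (prodGenerator M n) (fun z => ∑ a, P (Fin.cons a z)) =
        edgeForm s (prodGenerator M n) R := rfl
      linarith

end ProdGenerator

/-! ### Faber–Krahn maxima as suprema of edge forms -/

section FaberKrahn

variable {V : Type*} [Fintype V] [DecidableEq V] (G : SimpleGraph V) [DecidableRel G.Adj]

theorem adjMatrix_nonneg (x y : V) : 0 ≤ G.adjMatrix ℝ x y := by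
  rw [SimpleGraph.adjMatrix_apply]; split_ifs <;> norm_num

theorem sum_adjMatrix {d : ℕ} (hG : G.IsRegularOfDegree d) (x : V) :
    ∑ y, G.adjMatrix ℝ x y = d := by
  have h := G.adjMatrix_mulVec_const_apply (α := ℝ) (a := 1) (v := x)
  rw [hG x] at h
  simpa [Matrix.mulVec, dotProduct] using h

theorem adjMatrix_comm (x y : V) : G.adjMatrix ℝ x y = G.adjMatrix ℝ y x := by
  simp [SimpleGraph.adjMatrix_apply, G.adj_comm]

theorem edgeForm_le_graphRadius_cartPow {q : ℝ} (hq : 1 < q) {n : ℕ} (S : Finset (Fin n → V))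
    [Fintype (S : Set (Fin n → V))] {P : (Fin n → V) → ℝ} (hP : P ∈ stdSimplex ℝ (Fin n → V))
    (hS : ∀ x, x ∉ S → P x = 0) :
    edgeForm (1 / q) (prodGenerator (G.adjMatrix ℝ) n) P ≤
      graphRadius q ((cartPow G n).induce (S : Set (Fin n → V))) := by
  classical
  rw [← adjMatrix_cartPow]
  convert edgeForm_le_graphRadius hq (cartPow G n) S hP hS

theorem graphRadius_cartPow_le {q : ℝ} (hq : 1 < q) {n : ℕ} {S : Finset (Fin n → V)}
    (hne : S.Nonempty) [Fintype (S : Set (Fin n → V))] {B : ℝ}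
    (hB : ∀ P ∈ stdSimplex ℝ (Fin n → V), (∀ x, x ∉ S → P x = 0) →
      edgeForm (1 / q) (prodGenerator (G.adjMatrix ℝ) n) P ≤ B) :
    graphRadius q ((cartPow G n).induce (S : Set (Fin n → V))) ≤ B := by
  classical
  refine graphRadius_le hq (cartPow G n) hne fun P hP hS => ?_
  rw [adjMatrix_cartPow]
  exact hB P hP hS

theorem graphRadius_le_faberKrahn {q : ℝ} {n m : ℕ} {S : Finset (Fin n → V)} (hne : S.Nonempty)
    (hS : S.card ≤ m) :
    graphRadius q ((cartPow G n).induce (S : Set (Fin n → V))) ≤ faberKrahn G q n m := by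
  refine le_csSup (Set.Finite.bddAbove ((Set.finite_range fun S : Finset (Fin n → V) =>
    graphRadius q ((cartPow G n).induce (S : Set (Fin n → V)))).subset ?_)) ⟨S, hne, hS, rfl⟩
  rintro _ ⟨T, -, -, rfl⟩
  exact ⟨T, rfl⟩

theorem edgeForm_le_faberKrahn {q : ℝ} (hq : 1 < q) {n m : ℕ} {S : Finset (Fin n → V)}
    (hm : S.card ≤ m) {P : (Fin n → V) → ℝ} (hP : P ∈ stdSimplex ℝ (Fin n → V))
    (hS : ∀ x, x ∉ S → P x = 0) :
    edgeForm (1 / q) (prodGenerator (G.adjMatrix ℝ) n) P ≤ faberKrahn G q n m := by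
  refine (edgeForm_le_graphRadius_cartPow G hq S hP hS).trans
    (graphRadius_le_faberKrahn G ?_ hm)
  rw [Finset.nonempty_iff_ne_empty]
  rintro rfl
  have := hP.2
  simp [hS] at this

theorem faberKrahn_le [Nonempty V] {q : ℝ} (hq : 1 < q) {n m : ℕ} (hm : 1 ≤ m) {B : ℝ}
    (hB : ∀ P ∈ stdSimplex ℝ (Fin n → V), ∀ S : Finset (Fin n → V), S.card ≤ m →
      (∀ x, x ∉ S → P x = 0) → edgeForm (1 / q) (prodGenerator (G.adjMatrix ℝ) n) P ≤ B) :
    faberKrahn G q n m ≤ B := by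
  refine csSup_le ⟨_, {Classical.arbitrary _}, Finset.singleton_nonempty _, by simpa using hm,
    rfl⟩ ?_
  rintro _ ⟨S, hne, hS, rfl⟩
  exact graphRadius_cartPow_le G hq hne fun P hP h => hB P hP S hS h

/-! ### Normalized Dirichlet forms and entropies -/

theorem normDirichlet_eq {X : Type*} [Fintype X] {L A : Matrix X X ℝ} {D c q : ℝ} (hq : 1 < q)
    (hc : c ≠ 0) (hL : ∀ x, ∀ g : X → ℝ, ∑ y, L x y * g y = ∑ y, A x y * g y - D * g x)
    (hA : ∀ x y, A x y = A y x) {f : X → ℝ} (hf : ∀ x, 0 ≤ f x) (hf0 : f ≠ 0) :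
    normDirichlet L (fun _ => c) f (fun x => f x ^ (q - 1)) =
      D - edgeForm (1 / q) A (powDist q f) := by
  have hpos := sum_rpow_pos (q := q) hf hf0
  have hpow : ∀ x, f x * f x ^ (q - 1) = f x ^ q := fun x => by
    rcases (hf x).eq_or_lt with h | h
    · rw [← h, Real.zero_rpow (by linarith : q ≠ 0), zero_mul]
    · rw [← Real.rpow_one_add' h.le (by linarith)]; congr 1; ring
  have h1 : ∑ x, c * (f x * f x ^ (q - 1)) = c * ∑ x, f x ^ q := by
    rw [Finset.mul_sum]; simp only [hpow]
  have h2 : dirichlet L (fun _ => c) f (fun x => f x ^ (q - 1)) =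
      c * (D * ∑ x, f x ^ q - ∑ x, ∑ y, f x * A x y * f y ^ (q - 1)) := by
    have : ∀ x, ∑ y, L x y * f y * f x ^ (q - 1) * c =
        c * (∑ y, f y * A y x * f x ^ (q - 1) - D * f x ^ q) := by
      intro x
      have h3 : ∑ y, L x y * f y * f x ^ (q - 1) * c = (∑ y, L x y * f y) * (f x ^ (q - 1) * c) := by
        rw [Finset.sum_mul]; exact Finset.sum_congr rfl fun y _ => by ring
      have h4 : ∑ y, f y * A y x * f x ^ (q - 1) = (∑ y, A x y * f y) * f x ^ (q - 1) := by
        rw [Finset.sum_mul]; exact Finset.sum_congr rfl fun y _ => by rw [hA x y]; ring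
      rw [h3, hL, h4, ← hpow x]; ring
    simp only [dirichlet, this]
    rw [← Finset.mul_sum, Finset.sum_sub_distrib, ← Finset.mul_sum, Finset.sum_comm]
    ring
  rw [← rayleighQuot_eq hq A hf hf0, normDirichlet, h1, h2, mul_div_mul_left _ _ hc, sub_div,
    mul_div_cancel_right₀ _ hpos.ne', rayleighQuot]

theorem sum_graphGenerator_mul (d : ℕ) (x : V) (g : V → ℝ) :
    ∑ y, graphGenerator G d x y * g y = ∑ y, G.adjMatrix ℝ x y * g y - d * g x := by
  simp only [graphGenerator, Matrix.sub_apply, Matrix.smul_apply, Matrix.one_apply, smul_eq_mul,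
    sub_mul, Finset.sum_sub_distrib]
  simp

theorem sum_prodGenerator_graphGenerator_mul (d n : ℕ) (x : Fin n → V) (g : (Fin n → V) → ℝ) :
    ∑ y, prodGenerator (graphGenerator G d) n x y * g y =
      ∑ y, prodGenerator (G.adjMatrix ℝ) n x y * g y - n * d * g x := by
  rw [sum_prodGenerator_mul, sum_prodGenerator_mul]
  have : ∀ k, ∑ a, graphGenerator G d (x k) a * g (Function.update x k a) =
      ∑ a, G.adjMatrix ℝ (x k) a * g (Function.update x k a) - d * g x := fun k => by
    rw [sum_graphGenerator_mul G d (x k) fun a => g (Function.update x k a)]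
    simp
  simp only [this, Finset.sum_sub_distrib, Finset.sum_const, Finset.card_univ, Fintype.card_fin,
    nsmul_eq_mul, mul_assoc]

theorem normEnt_uniformWeight [Nonempty V] {q : ℝ} {f : V → ℝ} (hf : ∀ x, 0 ≤ f x)
    (hf0 : f ≠ 0) :
    normEnt (uniformWeight V) (fun x => f x ^ q) =
      Real.log (Fintype.card V) - shannonEntropy (powDist q f) := by
  have hpos := sum_rpow_pos (q := q) hf hf0
  have hN : (0 : ℝ) < Fintype.card V := by exact_mod_cast Fintype.card_pos
  set Z := ∑ z, f z ^ q with hZ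
  set E := ∑ x, f x ^ q * Real.log (f x ^ q) with hE
  have h1 : shannonEntropy (powDist q f) = Real.log Z - Z⁻¹ * E := by
    have : ∀ x, Real.negMulLog (powDist q f x) =
        Z⁻¹ * f x ^ q * Real.log Z - Z⁻¹ * (f x ^ q * Real.log (f x ^ q)) := by
      intro x
      rw [powDist, Real.negMulLog_mul, Real.negMulLog, Real.negMulLog, Real.log_inv]
      ring
    rw [shannonEntropy, Finset.sum_congr rfl fun x _ => this x, Finset.sum_sub_distrib,
      ← Finset.sum_mul, ← Finset.mul_sum, ← Finset.mul_sum, ← hZ, ← hE,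
      inv_mul_cancel₀ hpos.ne', one_mul]
  rw [h1, normEnt]
  simp only [uniformWeight, ← Finset.mul_sum]
  rw [← hZ, ← hE, one_div, Real.log_mul (inv_ne_zero hN.ne') hpos.ne', Real.log_inv]
  field_simp
  ring

open Classical in
theorem le_entZero_iff [Nonempty V] {n m : ℕ} (hn : 1 ≤ n) (hm : 1 ≤ m) {f : (Fin n → V) → ℝ}
    (hf : ∀ x, 0 ≤ f x) (hf0 : f ≠ 0) :
    Real.log (Fintype.card V) - 1 / (n : ℝ) * Real.log m ≤
        1 / (n : ℝ) * entZero (prodWeight (uniformWeight V) n) f ↔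
      (Finset.univ.filter fun x => 0 < f x).card ≤ m := by
  have hN : (0 : ℝ) < Fintype.card V := by exact_mod_cast Fintype.card_pos
  have hn' : (0 : ℝ) < n := by exact_mod_cast hn
  obtain ⟨x, hx⟩ := Function.ne_iff.1 hf0
  have hcard : 0 < (Finset.univ.filter fun x => 0 < f x).card :=
    Finset.card_pos.2 ⟨x, by simpa using (hf x).lt_of_ne (Ne.symm hx)⟩
  have hc' : (0 : ℝ) < (Finset.univ.filter fun x => 0 < f x).card := by exact_mod_cast hcard
  have hm' : (0 : ℝ) < m := by exact_mod_cast hm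
  have h1 : entZero (prodWeight (uniformWeight V) n) f =
      n * Real.log (Fintype.card V) - Real.log (Finset.univ.filter fun x => 0 < f x).card := by
    rw [entZero]
    simp only [prodWeight, uniformWeight, Finset.prod_const, Finset.card_univ, Fintype.card_fin,
      Finset.sum_const, nsmul_eq_mul]
    rw [Real.log_mul hc'.ne' (by positivity), Real.log_pow, one_div, Real.log_inv]
    ring
  have h2 : 1 / (n : ℝ) * entZero (prodWeight (uniformWeight V) n) f =
      Real.log (Fintype.card V) -
        1 / (n : ℝ) * Real.log (Finset.univ.filter fun x => 0 < f x).card := by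
    rw [h1]; field_simp
  rw [h2, sub_le_sub_iff_left, mul_le_mul_iff_right₀ (by positivity),
    Real.log_le_log_iff hc' hm', Nat.cast_le]

theorem graphXiZero_eq [Nonempty V] (d : ℕ) {q : ℝ} (hq : 1 < q) {n m : ℕ} (hn : 1 ≤ n)
    (hm : 1 ≤ m) :
    graphXiZero G d q n (Real.log (Fintype.card V) - 1 / (n : ℝ) * Real.log m) =
      ((d - 1 / (n : ℝ) * faberKrahn G q n m : ℝ) : EReal) := by
  classical
  have hN : (0 : ℝ) < Fintype.card V := by exact_mod_cast Fintype.card_pos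
  have hn' : (0 : ℝ) < n := by exact_mod_cast hn
  have hval : ∀ f : (Fin n → V) → ℝ, (∀ x, 0 ≤ f x) → f ≠ 0 →
      1 / (n : ℝ) * normDirichlet (prodGenerator (graphGenerator G d) n)
        (prodWeight (uniformWeight V) n) f (fun x => f x ^ (q - 1)) =
      d - 1 / (n : ℝ) *
        edgeForm (1 / q) (prodGenerator (G.adjMatrix ℝ) n) (powDist q f) := by
    intro f hf hf0
    have hw : prodWeight (uniformWeight V) n = fun _ => (1 / (Fintype.card V : ℝ)) ^ n := by
      funext x; simp [prodWeight, uniformWeight]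
    rw [hw, normDirichlet_eq hq (by positivity) (sum_prodGenerator_graphGenerator_mul G d n)
      (prodGenerator_comm (adjMatrix_comm G) n) hf hf0]
    field_simp
  apply le_antisymm
  · by_contra hlt
    obtain ⟨c, hc1, hc2⟩ := EReal.lt_iff_exists_real_btwn.1 (not_le.1 hlt)
    rw [EReal.coe_lt_coe_iff] at hc1
    have hle : faberKrahn G q n m ≤ n * (d - c) := by
      refine faberKrahn_le G hq hm fun P hP S hS hPS => ?_
      have hf : ∀ x, 0 ≤ P x ^ (1 / q) := fun x => Real.rpow_nonneg (hP.1 x) _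
      have hf0 := rpow_ne_zero_of_mem (q := q) hP
      have h3 : graphXiZero G d q n (Real.log (Fintype.card V) - 1 / (n : ℝ) * Real.log m) ≤
          ((d - 1 / (n : ℝ) * edgeForm (1 / q) (prodGenerator (G.adjMatrix ℝ) n) P : ℝ) :
            EReal) := by
        refine (iInf₂_le (fun x => P x ^ (1 / q))
          ⟨hf, hf0, (le_entZero_iff hn hm hf hf0).2 ?_⟩).trans (le_of_eq ?_)
        · rw [hval _ hf hf0, powDist_rpow hq hP]
        · refine (Finset.card_le_card fun x hx => ?_).trans hS
          by_contra hxS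
          have := (Finset.mem_filter.1 hx).2
          rw [hPS x hxS, Real.zero_rpow (one_div_pos_of_one_lt hq).ne'] at this
          exact lt_irrefl _ this
      have h4 := (hc2.trans_le h3).le
      rw [EReal.coe_le_coe_iff] at h4
      have h5 : 1 / (n : ℝ) * edgeForm (1 / q) (prodGenerator (G.adjMatrix ℝ) n) P ≤ d - c := by
        linarith
      rwa [one_div_mul_eq_div, div_le_iff₀' hn'] at h5
    have : 1 / (n : ℝ) * faberKrahn G q n m ≤ d - c := by
      rwa [one_div_mul_eq_div, div_le_iff₀' hn']
    linarith
  · refine le_iInf₂ fun f hf => ?_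
    obtain ⟨hf, hf0, hent⟩ := hf
    rw [hval f hf hf0, EReal.coe_le_coe_iff]
    have := edgeForm_le_faberKrahn G hq ((le_entZero_iff hn hm hf hf0).1 hent)
      (powDist_mem (q := q) hf hf0) fun x hx => by
        by_contra hne
        apply hx
        rw [Finset.mem_filter]
        exact ⟨Finset.mem_univ x, (powDist_pos_iff hq hf hf0 x).1
          (((powDist_mem hf hf0).1 x).lt_of_ne (Ne.symm hne))⟩
    have h := mul_le_mul_of_nonneg_left this (by positivity : 0 ≤ 1 / (n : ℝ))
    linarith

end FaberKrahn

/-! ### Planar convex hulls from above -/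

/-- Some point on a segment between two points of `T` lies on the vertical line through `z`,
not below `z`. -/
def SegmentAbove (T : Set (ℝ × ℝ)) (z : ℝ × ℝ) : Prop :=
  ∃ p ∈ T, ∃ r ∈ T, ∃ a : ℝ, 0 ≤ a ∧ a ≤ 1 ∧ a * p.1 + (1 - a) * r.1 = z.1 ∧
    z.2 ≤ a * p.2 + (1 - a) * r.2

theorem segmentAbove_of_sorted {T : Set (ℝ × ℝ)} {z p₁ p₂ p₃ : ℝ × ℝ} (h₁ : p₁ ∈ T) (h₂ : p₂ ∈ T)
    (h₃ : p₃ ∈ T) (h12 : p₁.1 ≤ p₂.1) (h23 : p₂.1 ≤ p₃.1) {a b c : ℝ} (ha : 0 ≤ a) (hb : 0 ≤ b)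
    (hc : 0 ≤ c) (habc : a + b + c = 1) (hz1 : a * p₁.1 + b * p₂.1 + c * p₃.1 = z.1)
    (hz2 : z.2 ≤ a * p₁.2 + b * p₂.2 + c * p₃.2) : SegmentAbove T z := by
  obtain ⟨x₁, y₁⟩ := p₁
  obtain ⟨x₂, y₂⟩ := p₂
  obtain ⟨x₃, y₃⟩ := p₃
  simp only at h12 h23 hz1 hz2
  obtain rfl : c = 1 - a - b := by linarith
  rcases (h12.trans h23).eq_or_lt with h13 | h13
  · obtain rfl : x₂ = x₁ := by linarith
    subst h13
    rcases le_total y₁ y₂ with h | h <;> rcases le_total y₂ y₃ with h' | h' <;>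
      rcases le_total y₁ y₃ with h'' | h''
    all_goals first
      | exact ⟨_, h₁, _, h₁, 1, by norm_num, le_rfl, by simp only; linarith,
          by simp only; nlinarith⟩
      | exact ⟨_, h₂, _, h₂, 1, by norm_num, le_rfl, by simp only; linarith,
          by simp only; nlinarith⟩
      | exact ⟨_, h₃, _, h₃, 1, by norm_num, le_rfl, by simp only; linarith,
          by simp only; nlinarith⟩
  have hD : 0 < x₃ - x₁ := by linarith
  by_cases hchord : 0 ≤ (x₃ - x₂) * y₁ + (x₂ - x₁) * y₃ - (x₃ - x₁) * y₂
  · have hk : ∃ k : ℝ, 0 ≤ k ∧ k ≤ 1 ∧ k * (x₃ - x₁) = x₃ - x₂ :=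
      ⟨(x₃ - x₂) / (x₃ - x₁), div_nonneg (by linarith) hD.le,
        (div_le_one hD).2 (by linarith), div_mul_cancel₀ _ hD.ne'⟩
    obtain ⟨k, hk0, hk1, hk⟩ := hk
    have hy : y₂ ≤ k * y₁ + (1 - k) * y₃ := by
      have : 0 ≤ (x₃ - x₁) * (k * y₁ + (1 - k) * y₃ - y₂) := by
        have h : (x₃ - x₁) * (k * y₁ + (1 - k) * y₃ - y₂) =
          k * (x₃ - x₁) * y₁ + ((x₃ - x₁) - k * (x₃ - x₁)) * y₃ - (x₃ - x₁) * y₂ := by ring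
        rw [h, hk]; linarith
      have := nonneg_of_mul_nonneg_right this hD
      linarith
    have hbk : b * k ≤ b := mul_le_of_le_one_right hb hk1
    refine ⟨_, h₁, _, h₃, a + b * k, by positivity, by linarith, ?_, ?_⟩
    · simp only
      have : b * (k * (x₃ - x₁)) = b * (x₃ - x₂) := by rw [hk]
      linarith
    · simp only
      have := mul_le_mul_of_nonneg_left hy hb
      linarith
  push Not at hchord
  rcases le_total (a * (x₂ - x₁)) ((1 - a - b) * (x₃ - x₂)) with h | h
  · rcases h23.eq_or_lt with h' | h'
    · subst h'
      have ha0 : a = 0 := by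
        have : a * (x₂ - x₁) ≤ 0 := by simpa using h
        nlinarith
      subst ha0
      exact ⟨_, h₂, _, h₃, b, hb, by linarith, by simp only; linarith, by simp only; linarith⟩
    · have hτ : ∃ τ : ℝ, 0 ≤ τ ∧ τ * (x₃ - x₂) = a :=
        ⟨a / (x₃ - x₂), div_nonneg ha (by linarith), div_mul_cancel₀ _ (by linarith)⟩
      obtain ⟨τ, hτ0, hτ⟩ := hτ
      have hle : τ * (x₂ - x₁) ≤ 1 - a - b := by
        have : (x₃ - x₂) * (τ * (x₂ - x₁)) ≤ (x₃ - x₂) * (1 - a - b) := by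
          calc _ = τ * (x₃ - x₂) * (x₂ - x₁) := by ring
            _ ≤ _ := by rw [hτ]; linarith
        exact le_of_mul_le_mul_left this (by linarith)
      refine ⟨_, h₂, _, h₃, b + τ * (x₃ - x₁), by positivity, by linarith, ?_, ?_⟩
      · simp only
        rw [← hz1, ← hτ]; ring
      · simp only
        have := mul_nonneg hτ0 (neg_nonneg.2 hchord.le)
        refine hz2.trans ?_
        rw [← hτ]
        linarith
  · rcases h12.eq_or_lt with h' | h'
    · subst h'
      have hc0 : 1 - a - b = 0 := by
        have : (1 - a - b) * (x₃ - x₁) ≤ 0 := by simpa using h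
        nlinarith
      refine ⟨_, h₁, _, h₂, a, ha, by linarith, ?_, ?_⟩
      · simp only
        rw [← hz1, hc0, show 1 - a = b by linarith]; ring
      · simp only
        rw [hc0] at hz2
        rw [show 1 - a = b by linarith]; linarith
    · have hτ : ∃ τ : ℝ, 0 ≤ τ ∧ τ * (x₂ - x₁) = 1 - a - b :=
        ⟨(1 - a - b) / (x₂ - x₁), div_nonneg hc (by linarith), div_mul_cancel₀ _ (by linarith)⟩
      obtain ⟨τ, hτ0, hτ⟩ := hτ
      have hle : τ * (x₃ - x₂) ≤ a := by
        have : (x₂ - x₁) * (τ * (x₃ - x₂)) ≤ (x₂ - x₁) * a := by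
          calc _ = τ * (x₂ - x₁) * (x₃ - x₂) := by ring
            _ ≤ _ := by rw [hτ]; linarith
        exact le_of_mul_le_mul_left this (by linarith)
      have h0 : 0 ≤ τ * (x₃ - x₂) := mul_nonneg hτ0 (by linarith)
      refine ⟨_, h₁, _, h₂, a - τ * (x₃ - x₂), by linarith, by linarith, ?_, ?_⟩
      · simp only
        rw [← hz1, ← hτ, show b = 1 - a - τ * (x₂ - x₁) by linarith]; ring
      · simp only
        have := mul_nonneg hτ0 (neg_nonneg.2 hchord.le)
        refine hz2.trans ?_
        rw [← hτ, show b = 1 - a - τ * (x₂ - x₁) by linarith]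
        linarith

theorem segmentAbove_of_three {T : Set (ℝ × ℝ)} {z p₁ p₂ p₃ : ℝ × ℝ} (h₁ : p₁ ∈ T) (h₂ : p₂ ∈ T)
    (h₃ : p₃ ∈ T) {a b c : ℝ} (ha : 0 ≤ a) (hb : 0 ≤ b)
    (hc : 0 ≤ c) (habc : a + b + c = 1) (hz1 : a * p₁.1 + b * p₂.1 + c * p₃.1 = z.1)
    (hz2 : z.2 ≤ a * p₁.2 + b * p₂.2 + c * p₃.2) : SegmentAbove T z := by
  rcases le_total p₁.1 p₂.1 with h | h <;> rcases le_total p₂.1 p₃.1 with h' | h' <;>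
    rcases le_total p₁.1 p₃.1 with h'' | h''
  all_goals first
    | exact segmentAbove_of_sorted h₁ h₂ h₃ (by assumption) (by assumption) ha hb hc
        (by linarith) (by linarith) (by linarith)
    | exact segmentAbove_of_sorted h₁ h₃ h₂ (by assumption) (by assumption) ha hc hb
        (by linarith) (by linarith) (by linarith)
    | exact segmentAbove_of_sorted h₂ h₁ h₃ (by assumption) (by assumption) hb ha hc
        (by linarith) (by linarith) (by linarith)
    | exact segmentAbove_of_sorted h₂ h₃ h₁ (by assumption) (by assumption) hb hc ha
        (by linarith) (by linarith) (by linarith)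
    | exact segmentAbove_of_sorted h₃ h₁ h₂ (by assumption) (by assumption) hc ha hb
        (by linarith) (by linarith) (by linarith)
    | exact segmentAbove_of_sorted h₃ h₂ h₁ (by assumption) (by assumption) hc hb ha
        (by linarith) (by linarith) (by linarith)

theorem SegmentAbove.mono {S T : Set (ℝ × ℝ)} (h : S ⊆ T) {z : ℝ × ℝ} (hz : SegmentAbove S z) :
    SegmentAbove T z := by
  obtain ⟨p, hp, r, hr, rest⟩ := hz
  exact ⟨p, h hp, r, h hr, rest⟩

/-- Every point of a planar convex hull lies on or below a segment between two of the points. -/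
theorem segmentAbove_of_mem_convexHull {T : Set (ℝ × ℝ)} {z : ℝ × ℝ} (hz : z ∈ convexHull ℝ T) :
    SegmentAbove T z := by
  classical
  rw [convexHull_eq_union_convexHull_finite_subsets] at hz
  simp only [Set.mem_iUnion] at hz
  obtain ⟨t, htT, hz⟩ := hz
  refine SegmentAbove.mono htT ?_
  clear htT
  induction t using Finset.induction_on generalizing z with
  | empty => simp at hz
  | insert p t _ ih =>
    have hp : p ∈ (↑(insert p t) : Set (ℝ × ℝ)) := by simp
    rcases t.eq_empty_or_nonempty with rfl | hne
    · obtain rfl : z = p := by simpa using hz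
      exact ⟨z, hp, z, hp, 1, by norm_num, le_rfl, by ring, by linarith⟩
    · rw [Finset.coe_insert, convexHull_insert (by simpa using hne), mem_convexJoin] at hz
      obtain ⟨p', hp', w, hw, hz⟩ := hz
      obtain rfl : p' = p := hp'
      obtain ⟨r₁, hr₁, r₂, hr₂, k, hk0, hk1, hk, hk'⟩ := ih hw
      obtain ⟨a, b, ha, hb, hab, rfl⟩ := hz
      have hsub : (t : Set (ℝ × ℝ)) ⊆ ↑(insert p' t) := by simp
      refine segmentAbove_of_three hp (hsub hr₁) (hsub hr₂) ha (mul_nonneg hb hk0)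
        (mul_nonneg hb (sub_nonneg.2 hk1)) (by linarith) ?_ ?_
      · simp only [Prod.fst_add, Prod.smul_fst, smul_eq_mul, ← hk]; ring
      · simp only [Prod.snd_add, Prod.smul_snd, smul_eq_mul]
        have := mul_le_mul_of_nonneg_left hk' hb
        linarith

/-! ### The concave envelope of the edge form as a function of the entropy -/

section Envelope

variable {V : Type*} [Fintype V] [DecidableEq V]

/-- The convex hull of the pairs (entropy, edge form) of the distributions on `V`. -/
def entropyEdgeHull (s : ℝ) (M : Matrix V V ℝ) : Set (ℝ × ℝ) :=
  convexHull ℝ ((fun p => (shannonEntropy p, edgeForm s M p)) '' stdSimplex ℝ V)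

/-- The largest height of a point of the hull whose entropy is at most `h`. -/
noncomputable def edgeEnvelope (s : ℝ) (M : Matrix V V ℝ) (h : ℝ) : ℝ :=
  sSup {t : ℝ | ∃ h', (h', t) ∈ entropyEdgeHull s M ∧ h' ≤ h}

variable {s : ℝ} {M : Matrix V V ℝ}

theorem mem_entropyEdgeHull {p : V → ℝ} (hp : p ∈ stdSimplex ℝ V) :
    (shannonEntropy p, edgeForm s M p) ∈ entropyEdgeHull s M :=
  subset_convexHull ℝ _ ⟨p, hp, rfl⟩

theorem convex_entropyEdgeHull : Convex ℝ (entropyEdgeHull s M) := convex_convexHull ℝ _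

/-- Every point of the hull is dominated by a proper mixture of two distributions. -/
theorem exists_pair_of_mem_entropyEdgeHull {z : ℝ × ℝ} (hz : z ∈ entropyEdgeHull s M) :
    ∃ P ∈ stdSimplex ℝ V, ∃ R ∈ stdSimplex ℝ V, ∃ a : ℝ, 0 < a ∧ a < 1 ∧
      a * shannonEntropy P + (1 - a) * shannonEntropy R = z.1 ∧
      z.2 ≤ a * edgeForm s M P + (1 - a) * edgeForm s M R := by
  obtain ⟨_, ⟨P, hP, rfl⟩, _, ⟨R, hR, rfl⟩, a, ha0, ha1, h1, h2⟩ :=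
    segmentAbove_of_mem_convexHull hz
  simp only at h1 h2
  rcases ha0.eq_or_lt with rfl | ha0
  · exact ⟨R, hR, R, hR, 1 / 2, by norm_num, by norm_num, by linarith, by linarith⟩
  rcases ha1.eq_or_lt with rfl | ha1
  · exact ⟨P, hP, P, hP, 1 / 2, by norm_num, by norm_num, by linarith, by linarith⟩
  exact ⟨P, hP, R, hR, a, ha0, ha1, h1, h2⟩

theorem snd_le_of_mem_entropyEdgeHull {D : ℝ} (hD : ∀ p ∈ stdSimplex ℝ V, edgeForm s M p ≤ D)
    {z : ℝ × ℝ} (hz : z ∈ entropyEdgeHull s M) : z.2 ≤ D := by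
  obtain ⟨P, hP, R, hR, a, ha0, ha1, -, h2⟩ := exists_pair_of_mem_entropyEdgeHull hz
  have h3 := mul_le_mul_of_nonneg_left (hD P hP) ha0.le
  have h4 := mul_le_mul_of_nonneg_left (hD R hR) (sub_nonneg.2 ha1.le)
  linarith

theorem le_edgeEnvelope (hs0 : 0 < s) (hs1 : s < 1) {z : ℝ × ℝ} (hz : z ∈ entropyEdgeHull s M)
    {h : ℝ} (hh : z.1 ≤ h) : z.2 ≤ edgeEnvelope s M h := by
  obtain ⟨D, hD⟩ := bddAbove_edgeForm hs0 hs1 M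
  refine le_csSup ⟨D, ?_⟩ ⟨z.1, hz, hh⟩
  rintro t ⟨h', ht, -⟩
  exact snd_le_of_mem_entropyEdgeHull (fun p hp => hD ⟨p, hp, rfl⟩) ht

theorem exists_entropy_zero [Nonempty V] (hM : ∀ x y, 0 ≤ M x y) :
    ∃ t : ℝ, 0 ≤ t ∧ ((0 : ℝ), t) ∈ entropyEdgeHull s M := by
  have hp := single_mem_stdSimplex ℝ (Classical.arbitrary V)
  refine ⟨_, edgeForm_nonneg (s := s) hM hp.1, ?_⟩
  convert mem_entropyEdgeHull (s := s) (M := M) hp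
  symm
  refine Finset.sum_eq_zero fun x _ => ?_
  by_cases hx : x = Classical.arbitrary V
  · rw [hx, Pi.single_eq_same, Real.negMulLog_one]
  · rw [Pi.single_eq_of_ne hx, Real.negMulLog_zero]

theorem edgeEnvelope_le [Nonempty V] (hM : ∀ x y, 0 ≤ M x y) {h B : ℝ} (hh : 0 ≤ h)
    (hB : ∀ z ∈ entropyEdgeHull s M, z.1 ≤ h → z.2 ≤ B) : edgeEnvelope s M h ≤ B := by
  obtain ⟨t, -, ht⟩ := exists_entropy_zero (s := s) hM
  refine csSup_le ⟨t, 0, ht, hh⟩ ?_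
  rintro t ⟨h', ht, hh'⟩
  exact hB _ ht hh'

theorem exists_lt_of_lt_edgeEnvelope [Nonempty V] (hM : ∀ x y, 0 ≤ M x y) {h c : ℝ} (hh : 0 ≤ h)
    (hc : c < edgeEnvelope s M h) : ∃ z ∈ entropyEdgeHull s M, z.1 ≤ h ∧ c < z.2 := by
  by_contra! hne
  exact hc.not_ge (edgeEnvelope_le hM hh hne)

theorem edgeEnvelope_mono [Nonempty V] (hs0 : 0 < s) (hs1 : s < 1) (hM : ∀ x y, 0 ≤ M x y)
    {h h' : ℝ} (hh : 0 ≤ h) (hle : h ≤ h') : edgeEnvelope s M h ≤ edgeEnvelope s M h' :=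
  edgeEnvelope_le hM hh fun _ hz hzh => le_edgeEnvelope hs0 hs1 hz (hzh.trans hle)

/-- Below a positive entropy level the envelope is approached at strictly smaller levels. -/
theorem exists_fst_lt_of_lt_edgeEnvelope [Nonempty V] (hM : ∀ x y, 0 ≤ M x y) {h c : ℝ}
    (hh : 0 < h) (hc : c < edgeEnvelope s M h) :
    ∃ z ∈ entropyEdgeHull s M, z.1 < h ∧ c < z.2 := by
  obtain ⟨z, hz, hzh, hzc⟩ := exists_lt_of_lt_edgeEnvelope hM hh.le hc
  obtain ⟨t, ht0, ht⟩ := exists_entropy_zero (s := s) hM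
  have hlim : Tendsto (fun a : ℝ => (1 - a) * z.2) (𝓝[>] 0) (𝓝 ((1 - 0) * z.2)) :=
    (Continuous.tendsto (by fun_prop) 0).mono_left nhdsWithin_le_nhds
  have hev := hlim.eventually (lt_mem_nhds (by simpa using hzc))
  have hlt1 : ∀ᶠ a : ℝ in 𝓝[>] 0, a < 1 := nhdsWithin_le_nhds (gt_mem_nhds one_pos)
  obtain ⟨a, hac, ha1, ha0⟩ := (hev.and (hlt1.and self_mem_nhdsWithin)).exists
  have ha0 : 0 < a := ha0
  refine ⟨_, convex_entropyEdgeHull hz ht (sub_nonneg.2 ha1.le) ha0.le (by ring), ?_, ?_⟩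
  · simp only [Prod.fst_add, Prod.smul_fst, smul_eq_mul, mul_zero, add_zero]
    have := mul_le_mul_of_nonneg_left hzh (sub_nonneg.2 ha1.le)
    nlinarith
  · simp only [Prod.snd_add, Prod.smul_snd, smul_eq_mul]
    have := mul_nonneg ha0.le ht0
    linarith

theorem exists_forall_edgeEnvelope_le [Nonempty V] (hs0 : 0 < s) (hs1 : s < 1)
    (hM : ∀ x y, 0 ≤ M x y) {h c : ℝ} (hc : edgeEnvelope s M h < c) :
    ∃ h₀ > h, ∀ h', 0 ≤ h' → h' < h₀ → edgeEnvelope s M h' ≤ c := by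
  let ent : (V → ℝ) × (V → ℝ) × ℝ → ℝ := fun w =>
    w.2.2 * shannonEntropy w.1 + (1 - w.2.2) * shannonEntropy w.2.1
  let edg : (V → ℝ) × (V → ℝ) × ℝ → ℝ := fun w =>
    w.2.2 * edgeForm s M w.1 + (1 - w.2.2) * edgeForm s M w.2.1
  have hφ := continuous_edgeForm hs0 hs1 M
  have hH := continuous_shannonEntropy (X := V)
  have hent : Continuous ent := by fun_prop
  have hedg : Continuous edg := by fun_prop
  let Z : Set ((V → ℝ) × (V → ℝ) × ℝ) :=
    (stdSimplex ℝ V ×ˢ stdSimplex ℝ V ×ˢ Set.Icc 0 1) ∩ {w | c ≤ edg w}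
  have hZ : IsCompact Z := ((isCompact_stdSimplex ℝ V).prod ((isCompact_stdSimplex ℝ V).prod
    isCompact_Icc)).inter_right (isClosed_le continuous_const hedg)
  have hpair : ∀ z ∈ entropyEdgeHull s M, c < z.2 → ∃ w ∈ Z, ent w = z.1 := by
    intro z hz hzc
    obtain ⟨P, hP, R, hR, a, ha0, ha1, h1, h2⟩ := exists_pair_of_mem_entropyEdgeHull hz
    exact ⟨(P, R, a), ⟨⟨hP, hR, ha0.le, ha1.le⟩, hzc.le.trans h2⟩, h1⟩
  rcases Z.eq_empty_or_nonempty with hemp | hne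
  · refine ⟨h + 1, by linarith, fun h' hh' _ => edgeEnvelope_le hM hh' fun z hz _ => ?_⟩
    by_contra! hzc
    obtain ⟨w, hw, -⟩ := hpair z hz hzc
    rw [hemp] at hw
    exact hw
  · obtain ⟨w, hw, hmin⟩ := hZ.exists_isMinOn hne hent.continuousOn
    refine ⟨ent w, ?_, fun h' hh' hlt => edgeEnvelope_le hM hh' fun z hz hzh => ?_⟩
    · by_contra! hle
      obtain ⟨⟨hP, hR, ha0, ha1⟩, hcw⟩ := hw
      have hmem := convex_entropyEdgeHull (s := s) (M := M) (mem_entropyEdgeHull hP)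
        (mem_entropyEdgeHull hR) ha0 (sub_nonneg.2 ha1) (by ring)
      have : edg w ≤ edgeEnvelope s M h := le_edgeEnvelope hs0 hs1 hmem hle
      exact (this.trans_lt hc).not_ge hcw
    · by_contra! hzc
      obtain ⟨w', hw', hww'⟩ := hpair z hz hzc
      have := hmin hw'
      simp only [Set.mem_ofPred_eq] at this
      linarith

theorem tendsto_edgeEnvelope [Nonempty V] (hs0 : 0 < s) (hs1 : s < 1) (hM : ∀ x y, 0 ≤ M x y)
    {h : ℝ} (hh : 0 ≤ h) {u : ℕ → ℝ} (hu : Tendsto u atTop (𝓝 h)) (hu0 : ∀ᶠ n in atTop, 0 ≤ u n) :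
    Tendsto (fun n => edgeEnvelope s M (u n)) atTop (𝓝 (edgeEnvelope s M h)) := by
  rw [tendsto_order]
  constructor
  · intro c hc
    rcases hh.eq_or_lt with rfl | hh
    · filter_upwards [hu0] with n hn
      exact hc.trans_le (edgeEnvelope_mono hs0 hs1 hM le_rfl hn)
    · obtain ⟨z, hz, hzh, hzc⟩ := exists_fst_lt_of_lt_edgeEnvelope hM hh hc
      filter_upwards [hu.eventually (lt_mem_nhds hzh)] with n hn
      exact hzc.trans_le (le_edgeEnvelope hs0 hs1 hz hn.le)
  · intro c hc
    obtain ⟨c', hc1, hc2⟩ := exists_between hc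
    obtain ⟨h₀, hh₀, hle⟩ := exists_forall_edgeEnvelope_le hs0 hs1 hM hc1
    filter_upwards [hu0, hu.eventually (gt_mem_nhds hh₀)] with n hn hn'
    exact (hle _ hn hn').trans_lt hc2

/-! ### The convex envelope of the log-Sobolev function -/

variable (G : SimpleGraph V) [DecidableRel G.Adj] {d : ℕ} {q : ℝ}

theorem normDirichlet_graphGenerator [Nonempty V] (d : ℕ) (hq : 1 < q) {f : V → ℝ}
    (hf : ∀ x, 0 ≤ f x) (hf0 : f ≠ 0) :
    normDirichlet (graphGenerator G d) (uniformWeight V) f (fun x => f x ^ (q - 1)) =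
      d - edgeForm (1 / q) (G.adjMatrix ℝ) (powDist q f) := by
  have hN : (0 : ℝ) < Fintype.card V := by exact_mod_cast Fintype.card_pos
  exact normDirichlet_eq hq (one_div_pos.2 hN).ne' (sum_graphGenerator_mul G d) (adjMatrix_comm G) hf hf0

theorem graphXi_le_iff [Nonempty V] (d : ℕ) (hq : 1 < q) (a t : ℝ) :
    graphXi G d q a ≤ (t : EReal) ↔ ∃ P ∈ stdSimplex ℝ V,
      a ≤ Real.log (Fintype.card V) - shannonEntropy P ∧
      d - edgeForm (1 / q) (G.adjMatrix ℝ) P ≤ t := by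
  have h0 := one_div_pos_of_one_lt hq
  have h1 := one_div_lt_one_of_one_lt hq
  constructor
  · intro ht
    let Z : Set (V → ℝ) :=
      stdSimplex ℝ V ∩ {P | a ≤ Real.log (Fintype.card V) - shannonEntropy P}
    have hZ : IsCompact Z := (isCompact_stdSimplex ℝ V).inter_right
      (isClosed_le continuous_const (continuous_const.sub continuous_shannonEntropy))
    have hmem : ∀ f : V → ℝ, (∀ x, 0 ≤ f x) → f ≠ 0 →
        a ≤ normEnt (uniformWeight V) (fun x => f x ^ q) → powDist q f ∈ Z := by
      intro f hf hf0 hfa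
      rw [normEnt_uniformWeight hf hf0] at hfa
      exact ⟨powDist_mem hf hf0, hfa⟩
    rcases Z.eq_empty_or_nonempty with hemp | hne
    · exfalso
      have : (⊤ : EReal) ≤ graphXi G d q a := le_iInf₂ fun f hf => by
        have := hmem f hf.1 hf.2.1 hf.2.2
        rw [hemp] at this
        exact this.elim
      exact absurd (this.trans ht) (by simp)
    · obtain ⟨P, hP, hmax⟩ := hZ.exists_isMaxOn hne
        (continuous_edgeForm h0 h1 (G.adjMatrix ℝ)).continuousOn
      refine ⟨P, hP.1, hP.2, ?_⟩
      have : ((d - edgeForm (1 / q) (G.adjMatrix ℝ) P : ℝ) : EReal) ≤ graphXi G d q a :=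
        le_iInf₂ fun f hf => by
          rw [normDirichlet_graphGenerator G d hq hf.1 hf.2.1, EReal.coe_le_coe_iff]
          have := hmax (hmem f hf.1 hf.2.1 hf.2.2)
          simp only [Set.mem_ofPred_eq] at this
          linarith
      exact EReal.coe_le_coe_iff.1 (this.trans ht)
  · rintro ⟨P, hP, hPa, hPt⟩
    have hf : ∀ x, 0 ≤ P x ^ (1 / q) := fun x => Real.rpow_nonneg (hP.1 x) _
    have hf0 := rpow_ne_zero_of_mem (q := q) hP
    refine (iInf₂_le (fun x => P x ^ (1 / q)) ⟨hf, hf0, ?_⟩).trans ?_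
    · rw [normDirichlet_graphGenerator G d hq hf hf0, powDist_rpow hq hP]
      exact EReal.coe_le_coe_iff.2 hPt
    · rw [normEnt_uniformWeight hf hf0, powDist_rpow hq hP]
      exact hPa

theorem shannonEntropy_le_log_card_univ {p : V → ℝ} (hp : p ∈ stdSimplex ℝ V) :
    shannonEntropy p ≤ Real.log (Fintype.card V) :=
  shannonEntropy_le_log_card hp (S := Finset.univ) (by simp)

theorem edgeForm_adjMatrix_le (hG : G.IsRegularOfDegree d) (hs0 : 0 < s) (hs1 : s < 1) {p : V → ℝ}
    (hp : p ∈ stdSimplex ℝ V) : edgeForm s (G.adjMatrix ℝ) p ≤ d :=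
  edgeForm_le hs0 hs1 (adjMatrix_nonneg G) (fun x => (sum_adjMatrix G hG x).le)
    (fun y => by simp only [adjMatrix_comm G _ y]; exact (sum_adjMatrix G hG y).le) hp

theorem uniformWeight_mem [Nonempty V] : uniformWeight V ∈ stdSimplex ℝ V := by
  have hN : (0 : ℝ) < Fintype.card V := by exact_mod_cast Fintype.card_pos
  refine ⟨fun x => by unfold uniformWeight; positivity, ?_⟩
  simp [uniformWeight]

theorem edgeForm_uniformWeight [Nonempty V] (hG : G.IsRegularOfDegree d) :
    edgeForm s (G.adjMatrix ℝ) (uniformWeight V) = d := by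
  have hN : (0 : ℝ) < Fintype.card V := by exact_mod_cast Fintype.card_pos
  unfold edgeForm uniformWeight
  rw [rpow_mul_rpow_one_sub (by positivity)]
  simp only [← Finset.sum_mul, sum_adjMatrix G hG]
  simp only [Finset.sum_const, Finset.card_univ, nsmul_eq_mul]
  field_simp

theorem graphXiConv_eq [Nonempty V] (hG : G.IsRegularOfDegree d) (hq : 1 < q) {α : ℝ}
    (hα0 : 0 ≤ α) (hα1 : α ≤ Real.log (Fintype.card V)) :
    graphXiConv G d q α =
      ((d - edgeEnvelope (1 / q) (G.adjMatrix ℝ) (Real.log (Fintype.card V) - α) : ℝ) :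
        EReal) := by
  have h0 := one_div_pos_of_one_lt hq
  have h1 := one_div_lt_one_of_one_lt hq
  have hM := adjMatrix_nonneg G
  set N := Real.log (Fintype.card V) with hN
  set K := entropyEdgeHull (1 / q) (G.adjMatrix ℝ) with hK
  have hKconv : Convex ℝ K := convex_entropyEdgeHull
  set Epi : Set (ℝ × ℝ) := {p : ℝ × ℝ | p.1 ∈ Set.Ici (0 : ℝ) ∧ graphXi G d q p.1 ≤ (p.2 : EReal)}
    with hEpi
  apply le_antisymm
  · have hrefl : ∀ z ∈ K, (N - z.1, d - z.2) ∈ convexHull ℝ Epi := by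
      have hconv : Convex ℝ {z : ℝ × ℝ | (N - z.1, (d : ℝ) - z.2) ∈ convexHull ℝ Epi} := by
        intro z hz w hw a b ha hb hab
        have := convex_convexHull ℝ Epi hz hw ha hb hab
        simp only [Set.mem_ofPred_eq]
        convert this using 1
        ext
        · simp only [Prod.fst_add, Prod.smul_fst, smul_eq_mul]
          linear_combination (-N) * hab
        · simp only [Prod.snd_add, Prod.smul_snd, smul_eq_mul]
          linear_combination (-(d : ℝ)) * hab
      refine convexHull_min ?_ hconv
      rintro _ ⟨P, hP, rfl⟩
      refine subset_convexHull ℝ _ ⟨?_, ?_⟩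
      · exact sub_nonneg.2 (shannonEntropy_le_log_card_univ hP)
      · exact (graphXi_le_iff G d hq _ _).2 ⟨P, hP, le_rfl, le_rfl⟩
    by_contra hlt
    obtain ⟨c, hc1, hc2⟩ := EReal.lt_iff_exists_real_btwn.1 (not_le.1 hlt)
    rw [EReal.coe_lt_coe_iff] at hc1
    refine absurd (edgeEnvelope_le hM (sub_nonneg.2 hα1) (B := d - c) fun z hz hzh => ?_)
      (by rw [not_le]; linarith)
    have hz2 : z.2 ≤ d :=
      snd_le_of_mem_entropyEdgeHull (fun p hp => edgeForm_adjMatrix_le G hG h0 h1 hp) hz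
    have hzero : ((0 : ℝ), (d : ℝ) - z.2) ∈ convexHull ℝ Epi := by
      refine subset_convexHull ℝ _ ⟨le_refl (0 : ℝ), (graphXi_le_iff G d hq _ _).2
        ⟨_, uniformWeight_mem, sub_nonneg.2 (shannonEntropy_le_log_card_univ uniformWeight_mem),
          ?_⟩⟩
      rw [edgeForm_uniformWeight G hG]
      linarith
    have hmem : (α, (d : ℝ) - z.2) ∈ convexHull ℝ Epi := by
      rcases hα0.eq_or_lt with rfl | hα
      · exact hzero
      have hpos : 0 < N - z.1 := by linarith
      have hle : α / (N - z.1) ≤ 1 := (div_le_one hpos).2 (by linarith)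
      convert convex_convexHull ℝ Epi hzero (hrefl z hz) (sub_nonneg.2 hle)
        (div_nonneg hα0 hpos.le) (by ring) using 1
      ext
      · simp only [Prod.fst_add, Prod.smul_fst, smul_eq_mul]
        field_simp
        ring
      · simp only [Prod.snd_add, Prod.smul_snd, smul_eq_mul]
        ring
    have h3 : graphXiConv G d q α ≤ ((d - z.2 : ℝ) : EReal) :=
      iInf₂_le (f := fun (t : ℝ) _ => (t : EReal)) ((d : ℝ) - z.2) hmem
    have h4 := EReal.coe_lt_coe_iff.1 (hc2.trans_le h3)
    linarith
  · refine le_iInf₂ fun t ht => ?_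
    rw [EReal.coe_le_coe_iff]
    have hconv : Convex ℝ {p : ℝ × ℝ | ∃ z ∈ K, z.1 ≤ N - p.1 ∧ d - z.2 ≤ p.2} := by
      rintro p ⟨z, hz, hz1, hz2⟩ r ⟨w, hw, hw1, hw2⟩ a b ha hb hab
      refine ⟨_, hKconv hz hw ha hb hab, ?_, ?_⟩
      · simp only [Prod.fst_add, Prod.smul_fst, smul_eq_mul]
        have h3 := mul_le_mul_of_nonneg_left hz1 ha
        have h4 := mul_le_mul_of_nonneg_left hw1 hb
        have h5 : a * N + b * N = N := by rw [← add_mul, hab, one_mul]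
        linarith
      · simp only [Prod.snd_add, Prod.smul_snd, smul_eq_mul]
        have h3 := mul_le_mul_of_nonneg_left hz2 ha
        have h4 := mul_le_mul_of_nonneg_left hw2 hb
        have h5 : a * (d : ℝ) + b * d = d := by rw [← add_mul, hab, one_mul]
        linarith
    have hsub : convexHull ℝ Epi ⊆ {p : ℝ × ℝ | ∃ z ∈ K, z.1 ≤ N - p.1 ∧ d - z.2 ≤ p.2} := by
      refine convexHull_min ?_ hconv
      rintro ⟨a, t⟩ ⟨-, hp⟩
      obtain ⟨P, hP, hP1, hP2⟩ := (graphXi_le_iff G d hq _ _).1 hp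
      exact ⟨_, mem_entropyEdgeHull hP, by simp only at hP1 ⊢; linarith, hP2⟩
    obtain ⟨z, hz, hz1, hz2⟩ := hsub ht
    have := le_edgeEnvelope h0 h1 hz hz1
    simp only at hz2
    linarith

/-- The Faber–Krahn maximum is at most `n` times the envelope. -/
theorem faberKrahn_le_edgeEnvelope [Nonempty V] (hq : 1 < q) {n m : ℕ} (hn : 1 ≤ n)
    (hm : 1 ≤ m) :
    1 / (n : ℝ) * faberKrahn G q n m ≤
      edgeEnvelope (1 / q) (G.adjMatrix ℝ) (1 / (n : ℝ) * Real.log m) := by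
  have h0 := one_div_pos_of_one_lt hq
  have h1 := one_div_lt_one_of_one_lt hq
  have hn' : (0 : ℝ) < n := by exact_mod_cast hn
  rw [one_div_mul_eq_div, div_le_iff₀' hn']
  refine faberKrahn_le G hq hm fun P hP S hS hPS => ?_
  obtain ⟨z, hz, hz1, hz2⟩ := exists_mem_convex_of_word h0 h1 (adjMatrix_nonneg G)
    (convex_entropyEdgeHull (s := 1 / q) (M := G.adjMatrix ℝ)) (fun p hp => mem_entropyEdgeHull hp)
    n hP
  refine hz2.trans (mul_le_mul_of_nonneg_left (le_edgeEnvelope h0 h1 hz ?_) hn'.le)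
  rw [one_div_mul_eq_div, le_div_iff₀' hn']
  have hne : S.Nonempty := by
    rw [Finset.nonempty_iff_ne_empty]
    rintro rfl
    have := hP.2
    simp [hPS] at this
  have hSpos : (0 : ℝ) < S.card := by exact_mod_cast hne.card_pos
  exact (hz1.trans (shannonEntropy_le_log_card hP hPS)).trans
    (Real.log_le_log hSpos (by exact_mod_cast hS))

end Envelope

/-! ### Typical words on a block of coordinates -/

section Typical

variable {V : Type*} [Fintype V] [DecidableEq V] {n : ℕ}

/-- The number of occurrences of a letter in a block of coordinates of a word. -/
def letterCount (B : Finset (Fin n)) (x : Fin n → V) (a : V) : ℕ := (B.filter fun i => x i = a).card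

/-- The word `x` is `ε`-typical for `Q` on the block `B`. -/
def BlockTypical (B : Finset (Fin n)) (ε : ℝ) (Q : V → ℝ) (x : Fin n → V) : Prop :=
  ∀ a, |(letterCount B x a : ℝ) - B.card * Q a| ≤ ε * (B.card * Q a)

theorem blockTypical_of_subtype (p : Fin n → Prop) [DecidablePred p] (ε : ℝ) (Q : V → ℝ)
    (x : Fin n → V) :
    (fun i : {i : Fin n // p i} => x i.1) ∈ typicalSet {i : Fin n // p i} ε Q ↔
      BlockTypical (Finset.univ.filter p) ε Q x := by
  classical
  simp only [typicalSet, BlockTypical, Set.mem_ofPred_eq]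
  refine forall_congr' fun a => ?_
  have h1 : Fintype.card {i : Fin n // p i} = (Finset.univ.filter p).card := Fintype.card_subtype p
  have h2 : (Finset.univ.filter fun i : {i : Fin n // p i} => x i.1 = a).card =
      letterCount (Finset.univ.filter p) x a := by
    rw [letterCount, Finset.card_filter, Finset.card_filter]
    exact (Finset.sum_subtype (Finset.univ.filter p) (by simp)
      (fun i => if x i = a then 1 else 0)).symm
  rw [h1, ← h2]

theorem mem_typicalProduct_iff (ε : ℝ) (Q R : V → ℝ) (k : ℕ) (x : Fin n → V) :
    x ∈ typicalProduct ε Q R n k ↔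
      BlockTypical (Finset.univ.filter fun i : Fin n => i.val < k) ε Q x ∧
      BlockTypical (Finset.univ.filter fun i : Fin n => ¬ i.val < k) ε R x := by
  rw [← blockTypical_of_subtype, ← blockTypical_of_subtype]
  simp [typicalProduct]

theorem sum_letterCount_mul (B : Finset (Fin n)) (x : Fin n → V) (g : V → ℝ) :
    ∑ a, letterCount B x a * g a = ∑ i ∈ B, g (x i) := by
  rw [← Finset.sum_fiberwise B x]
  refine Finset.sum_congr rfl fun a _ => ?_
  rw [Finset.sum_congr rfl fun i hi => by rw [(Finset.mem_filter.1 hi).2], Finset.sum_const,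
    nsmul_eq_mul, letterCount]

theorem BlockTypical.pos {B : Finset (Fin n)} {ε : ℝ} {Q : V → ℝ} (hQ : Q ∈ stdSimplex ℝ V)
    {x : Fin n → V} (hx : BlockTypical B ε Q x) {i : Fin n} (hi : i ∈ B) : 0 < Q (x i) := by
  refine (hQ.1 _).lt_of_ne fun h => ?_
  have := hx (x i)
  rw [← h] at this
  have h0 : letterCount B x (x i) = 0 := by simpa using this
  rw [letterCount, Finset.card_eq_zero] at h0
  exact Finset.notMem_empty i (h0 ▸ Finset.mem_filter.2 ⟨hi, rfl⟩)

theorem BlockTypical.exp_le_prod {B : Finset (Fin n)} {ε : ℝ} {Q : V → ℝ}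
    (hQ : Q ∈ stdSimplex ℝ V) {x : Fin n → V} (hx : BlockTypical B ε Q x) :
    Real.exp (-((1 + ε) * (B.card * shannonEntropy Q))) ≤ ∏ i ∈ B, Q (x i) := by
  have h1 : ∏ i ∈ B, Q (x i) = Real.exp (∑ i ∈ B, Real.log (Q (x i))) := by
    rw [Real.exp_sum]
    exact Finset.prod_congr rfl fun i hi => (Real.exp_log (hx.pos hQ hi)).symm
  rw [h1, Real.exp_le_exp, ← sum_letterCount_mul B x fun a => Real.log (Q a), shannonEntropy,
    Finset.mul_sum, Finset.mul_sum, ← Finset.sum_neg_distrib]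
  refine Finset.sum_le_sum fun a _ => ?_
  have h2 := (abs_le.1 (hx a)).2
  have h3 : Real.log (Q a) ≤ 0 :=
    Real.log_nonpos (hQ.1 a) (mem_Icc_of_mem_stdSimplex hQ a).2
  have h4 : (letterCount B x a : ℝ) ≤ (1 + ε) * (B.card * Q a) := by linarith
  have h5 := mul_le_mul_of_nonpos_right h4 h3
  rw [Real.negMulLog]
  linarith

/-- The size of a product of two typical sets. -/
theorem card_typicalProduct_le {ε : ℝ} {Q R : V → ℝ} (hQ : Q ∈ stdSimplex ℝ V)
    (hR : R ∈ stdSimplex ℝ V) (k : ℕ) :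
    ((typicalProduct ε Q R n k).card : ℝ) ≤ Real.exp ((1 + ε) *
      ((Finset.univ.filter fun i : Fin n => i.val < k).card * shannonEntropy Q +
        (Finset.univ.filter fun i : Fin n => ¬ i.val < k).card * shannonEntropy R)) := by
  set B := Finset.univ.filter fun i : Fin n => i.val < k with hB
  set B' := Finset.univ.filter fun i : Fin n => ¬ i.val < k with hB'
  let p : Fin n → V → ℝ := fun i => if i.val < k then Q else R
  have hp : ∀ i, p i ∈ stdSimplex ℝ V := fun i => by
    simp only [p]; split_ifs <;> assumption
  have hprod : ∀ x, piWeight p x = (∏ i ∈ B, Q (x i)) * ∏ i ∈ B', R (x i) := fun x => by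
    rw [piWeight, ← Finset.prod_filter_mul_prod_filter_not Finset.univ fun i : Fin n => i.val < k]
    congr 1
    · exact Finset.prod_congr rfl fun i hi => by simp [p, (Finset.mem_filter.1 hi).2]
    · refine Finset.prod_congr rfl fun i hi => ?_
      have := (Finset.mem_filter.1 hi).2
      simp only [p, if_neg this]
  set E := (1 + ε) * (B.card * shannonEntropy Q + B'.card * shannonEntropy R) with hE
  have hle : ∀ x ∈ typicalProduct ε Q R n k, Real.exp (-E) ≤ piWeight p x := fun x hx => by
    obtain ⟨h1, h2⟩ := (mem_typicalProduct_iff ε Q R k x).1 hx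
    rw [hprod]
    have h3 := h1.exp_le_prod hQ
    have h4 := h2.exp_le_prod hR
    calc Real.exp (-E) = Real.exp (-((1 + ε) * (B.card * shannonEntropy Q))) *
          Real.exp (-((1 + ε) * (B'.card * shannonEntropy R))) := by
          rw [← Real.exp_add, hE]; congr 1; ring
      _ ≤ _ := mul_le_mul h3 h4 (Real.exp_pos _).le (Finset.prod_nonneg fun i _ => hQ.1 _)
  have hsum : (typicalProduct ε Q R n k).card * Real.exp (-E) ≤ 1 := by
    rw [← (piWeight_mem hp).2, ← nsmul_eq_mul, ← Finset.sum_const]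
    exact (Finset.sum_le_sum hle).trans (Finset.sum_le_sum_of_subset_of_nonneg
      (Finset.subset_univ _) fun x _ _ => (piWeight_mem hp).1 x)
  rwa [Real.exp_neg, ← div_eq_mul_inv, div_le_one (Real.exp_pos _)] at hsum

/-! ### Concentration -/

theorem sum_piWeight_mul_mul {p : Fin n → V → ℝ} {i j : Fin n} (hij : i ≠ j) {g h : V → ℝ}
    (hg : ∑ b, p i b * g b = 0) : ∑ x, piWeight p x * (g (x i) * h (x j)) = 0 := by
  have := sum_piWeight fun l b => p l b * ((if i = l then g b else 1) * (if j = l then h b else 1))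
  rw [Finset.prod_eq_zero (Finset.mem_univ i) (by simpa [hij.symm] using hg)] at this
  rw [← this]
  refine Finset.sum_congr rfl fun x _ => ?_
  simp only [piWeight, Finset.prod_mul_distrib, Finset.prod_ite_eq, Finset.mem_univ, if_true]

theorem sum_piWeight_mul_sq_le {p : Fin n → V → ℝ} (hp : ∀ i, p i ∈ stdSimplex ℝ V)
    (B : Finset (Fin n)) {Q : V → ℝ} (hpQ : ∀ i ∈ B, p i = Q) (hQ : Q ∈ stdSimplex ℝ V) (a : V) :
    ∑ x, piWeight p x * ((letterCount B x a : ℝ) - B.card * Q a) ^ 2 ≤ B.card := by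
  let g : V → ℝ := fun b => (if b = a then 1 else 0) - Q a
  have hg0 : ∑ b, Q b * g b = 0 := by
    simp only [g, mul_sub, Finset.sum_sub_distrib, ← Finset.sum_mul, hQ.2]
    simp
  have hg1 : ∀ b, g b * g b ≤ 1 := fun b => by
    have h0 := hQ.1 a
    have h1 := (mem_Icc_of_mem_stdSimplex hQ a).2
    simp only [g]
    split_ifs <;> nlinarith
  have hcount : ∀ x : Fin n → V, (letterCount B x a : ℝ) - B.card * Q a = ∑ i ∈ B, g (x i) := by
    intro x
    simp only [g, Finset.sum_sub_distrib, Finset.sum_const, nsmul_eq_mul, letterCount,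
      Finset.card_filter]
    push_cast
    rfl
  have hexp : ∑ x, piWeight p x * ((letterCount B x a : ℝ) - B.card * Q a) ^ 2 =
      ∑ i ∈ B, ∑ j ∈ B, ∑ x, piWeight p x * (g (x i) * g (x j)) := by
    simp only [hcount, sq, Finset.sum_mul_sum]
    simp only [Finset.mul_sum]
    rw [Finset.sum_comm]
    refine Finset.sum_congr rfl fun i _ => ?_
    rw [Finset.sum_comm]
  rw [hexp]
  calc _ ≤ ∑ i ∈ B, (1 : ℝ) := Finset.sum_le_sum fun i hi => by
        rw [Finset.sum_eq_single_of_mem i hi fun j _ hj =>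
          sum_piWeight_mul_mul (Ne.symm hj) (by rw [hpQ i hi]; exact hg0)]
        rw [← (piWeight_mem hp).2]
        exact Finset.sum_le_sum fun x _ =>
          mul_le_of_le_one_right ((piWeight_mem hp).1 x) (hg1 _)
    _ = B.card := by simp

open Classical in
/-- Chebyshev's bound for the atypical words on a block. -/
theorem sum_not_blockTypical_le {p : Fin n → V → ℝ} (hp : ∀ i, p i ∈ stdSimplex ℝ V)
    {B : Finset (Fin n)} (hB : B.Nonempty) {Q Q' : V → ℝ} (hpQ : ∀ i ∈ B, p i = Q')
    (hQ : Q ∈ stdSimplex ℝ V) (hQ' : Q' ∈ stdSimplex ℝ V) {ε ε' : ℝ} (hε : ε' < ε)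
    (hQQ' : ∀ a, |Q' a - Q a| ≤ ε' * Q a) :
    ∑ x with ¬ BlockTypical B ε Q x, piWeight p x ≤
      (∑ a, 1 / ((ε - ε') * Q a) ^ 2) / B.card := by
  have hW := piWeight_mem hp
  have hc : (0 : ℝ) < B.card := by exact_mod_cast hB.card_pos
  have hbad : ∀ a, ∑ x with ¬ |(letterCount B x a : ℝ) - B.card * Q a| ≤ ε * (B.card * Q a),
      piWeight p x ≤ 1 / ((ε - ε') * Q a) ^ 2 / B.card := by
    intro a
    rcases (hQ.1 a).eq_or_lt with ha | ha
    · refine le_trans (le_of_eq (Finset.sum_eq_zero fun x hx => ?_)) (by positivity)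
      have hx := (Finset.mem_filter.1 hx).2
      rw [← ha] at hx
      have hne : letterCount B x a ≠ 0 := fun h0 => hx (by simp [h0])
      rw [letterCount, Finset.card_ne_zero] at hne
      obtain ⟨i, hi⟩ := hne
      obtain ⟨hiB, hia⟩ := Finset.mem_filter.1 hi
      refine Finset.prod_eq_zero (Finset.mem_univ i) ?_
      have := hQQ' a
      rw [← ha] at this
      rw [hpQ i hiB, hia]
      simpa using this
    · have hτ : 0 < (ε - ε') * (B.card * Q a) := mul_pos (sub_pos.2 hε) (mul_pos hc ha)
      have h1 := sum_piWeight_mul_sq_le hp B hpQ hQ' a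
      have h2 : ∑ x with ¬ |(letterCount B x a : ℝ) - B.card * Q a| ≤ ε * (B.card * Q a),
          piWeight p x * ((ε - ε') * (B.card * Q a)) ^ 2 ≤ B.card := by
        refine le_trans ?_ h1
        refine le_trans (Finset.sum_le_sum fun x hx => ?_)
          (Finset.sum_le_sum_of_subset_of_nonneg (Finset.filter_subset _ _)
            fun x _ _ => mul_nonneg (hW.1 x) (sq_nonneg _))
        refine mul_le_mul_of_nonneg_left ?_ (hW.1 x)
        have hx := not_le.1 (Finset.mem_filter.1 hx).2
        rw [sq_le_sq, abs_of_pos hτ]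
        have h3 : |(B.card : ℝ) * Q' a - B.card * Q a| ≤ ε' * (B.card * Q a) := by
          rw [← mul_sub, abs_mul, abs_of_pos hc]
          have := mul_le_mul_of_nonneg_left (hQQ' a) hc.le
          linarith
        have h4 := abs_sub_le (letterCount B x a : ℝ) (B.card * Q' a) (B.card * Q a)
        linarith
      rw [← Finset.sum_mul] at h2
      rw [← le_div_iff₀ (by positivity)] at h2
      refine h2.trans (le_of_eq ?_)
      have : ε - ε' ≠ 0 := (sub_pos.2 hε).ne'
      field_simp
  calc _ ≤ ∑ a, ∑ x with ¬ |(letterCount B x a : ℝ) - B.card * Q a| ≤ ε * (B.card * Q a),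
        piWeight p x := by
        simp only [Finset.sum_filter]
        rw [Finset.sum_comm]
        refine Finset.sum_le_sum fun x _ => ?_
        have hnn : ∀ a ∈ Finset.univ, 0 ≤ if ¬ |(letterCount B x a : ℝ) - B.card * Q a| ≤
            ε * (B.card * Q a) then piWeight p x else 0 := fun a _ => by
          split_ifs
          · exact le_rfl
          · exact hW.1 x
        by_cases hx : BlockTypical B ε Q x
        · rw [if_neg (not_not.2 hx)]
          exact Finset.sum_nonneg hnn
        · rw [if_pos hx]
          obtain ⟨a, ha⟩ := not_forall.1 hx
          refine le_trans (le_of_eq ?_) (Finset.single_le_sum hnn (Finset.mem_univ a))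
          rw [if_pos ha]
    _ ≤ _ := by
        rw [Finset.sum_div]
        exact Finset.sum_le_sum fun a _ => hbad a

end Typical

/-! ### Restricting a distribution to a set of large weight -/

theorem edgeForm_sub_le_restrict {X : Type*} [Fintype X] [DecidableEq X] {s : ℝ} (hs0 : 0 < s) (hs1 : s < 1)
    {A : Matrix X X ℝ} (hA : ∀ x y, 0 ≤ A x y) {D : ℝ} (hrow : ∀ x, ∑ y, A x y = D)
    (hcol : ∀ y, ∑ x, A x y = D) (hD : 0 ≤ D) {P : X → ℝ} (hP : P ∈ stdSimplex ℝ X)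
    (S : Finset X) {δ : ℝ} (hδ : ∑ x with x ∉ S, P x ≤ δ) :
    edgeForm s A P - D * (δ ^ s + δ ^ (1 - s)) ≤
      edgeForm s A (fun x => if x ∈ S then P x else 0) := by
  have hδ0 : 0 ≤ δ := (Finset.sum_nonneg fun x _ => hP.1 x).trans hδ
  set F : X → X → ℝ := fun x y => A x y * (P x ^ s * P y ^ (1 - s)) with hF
  have hF0 : ∀ x y, 0 ≤ F x y := fun x y =>
    mul_nonneg (hA x y) (mul_nonneg (Real.rpow_nonneg (hP.1 x) _) (Real.rpow_nonneg (hP.1 y) _))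
  have hAP0 : ∀ x y z, 0 ≤ A x y * P z := fun x y z => mul_nonneg (hA x y) (hP.1 z)
  have hR : ∑ p : X × X, A p.1 p.2 * P p.1 = D := by
    rw [Fintype.sum_prod_type]
    simp only [← Finset.sum_mul, hrow]
    rw [← Finset.mul_sum, hP.2, mul_one]
  have hC : ∑ p : X × X, A p.1 p.2 * P p.2 = D := by
    rw [Fintype.sum_prod_type_right]
    simp only [← Finset.sum_mul, hcol]
    rw [← Finset.mul_sum, hP.2, mul_one]
  have h1 : ∑ p : X × X with p.1 ∉ S, F p.1 p.2 ≤ D * δ ^ s := by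
    refine (sum_edge_le hs0 hs1 hA hP.1 _).trans ?_
    have ha : ∑ p : X × X with p.1 ∉ S, A p.1 p.2 * P p.1 ≤ D * δ := by
      rw [Finset.sum_filter, Fintype.sum_prod_type]
      calc _ = D * ∑ x with x ∉ S, P x := by
            rw [Finset.mul_sum, Finset.sum_filter]
            refine Finset.sum_congr rfl fun x _ => ?_
            split_ifs
            · simp
            · rw [← hrow x, Finset.sum_mul]
        _ ≤ _ := mul_le_mul_of_nonneg_left hδ hD
    have hb : ∑ p : X × X with p.1 ∉ S, A p.1 p.2 * P p.2 ≤ D := by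
      rw [← hC]
      exact Finset.sum_le_sum_of_subset_of_nonneg (Finset.filter_subset _ _)
        fun p _ _ => hAP0 _ _ _
    calc _ ≤ (D * δ) ^ s * D ^ (1 - s) := mul_le_mul
          (Real.rpow_le_rpow (Finset.sum_nonneg fun p _ => hAP0 _ _ _) ha hs0.le)
          (Real.rpow_le_rpow (Finset.sum_nonneg fun p _ => hAP0 _ _ _) hb (by linarith))
          (Real.rpow_nonneg (Finset.sum_nonneg fun p _ => hAP0 _ _ _) _)
          (Real.rpow_nonneg (mul_nonneg hD hδ0) _)
      _ = D * δ ^ s := by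
          have := mul_rpow_mul_rpow_one_sub (s := s) hD hδ0 zero_le_one
          simpa using this
  have h2 : ∑ p : X × X with p.2 ∉ S, F p.1 p.2 ≤ D * δ ^ (1 - s) := by
    refine (sum_edge_le hs0 hs1 hA hP.1 _).trans ?_
    have hb : ∑ p : X × X with p.2 ∉ S, A p.1 p.2 * P p.2 ≤ D * δ := by
      rw [Finset.sum_filter, Fintype.sum_prod_type_right]
      calc _ = D * ∑ x with x ∉ S, P x := by
            rw [Finset.mul_sum, Finset.sum_filter]
            refine Finset.sum_congr rfl fun x _ => ?_
            split_ifs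
            · simp
            · rw [← hcol x, Finset.sum_mul]
        _ ≤ _ := mul_le_mul_of_nonneg_left hδ hD
    have ha : ∑ p : X × X with p.2 ∉ S, A p.1 p.2 * P p.1 ≤ D := by
      rw [← hR]
      exact Finset.sum_le_sum_of_subset_of_nonneg (Finset.filter_subset _ _)
        fun p _ _ => hAP0 _ _ _
    calc _ ≤ D ^ s * (D * δ) ^ (1 - s) := mul_le_mul
          (Real.rpow_le_rpow (Finset.sum_nonneg fun p _ => hAP0 _ _ _) ha hs0.le)
          (Real.rpow_le_rpow (Finset.sum_nonneg fun p _ => hAP0 _ _ _) hb (by linarith))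
          (Real.rpow_nonneg (Finset.sum_nonneg fun p _ => hAP0 _ _ _) _)
          (Real.rpow_nonneg hD _)
      _ = D * δ ^ (1 - s) := by
          have := mul_rpow_mul_rpow_one_sub (s := s) hD zero_le_one hδ0
          simpa using this
  have hsplit : edgeForm s A P ≤ edgeForm s A (fun x => if x ∈ S then P x else 0) +
      ∑ p : X × X with p.1 ∉ S, F p.1 p.2 + ∑ p : X × X with p.2 ∉ S, F p.1 p.2 := by
    unfold edgeForm
    rw [← Fintype.sum_prod_type' fun x y => A x y * (P x ^ s * P y ^ (1 - s)),
      ← Fintype.sum_prod_type' fun x y => A x y * ((if x ∈ S then P x else 0) ^ s *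
        (if y ∈ S then P y else 0) ^ (1 - s)),
      Finset.sum_filter, Finset.sum_filter, ← Finset.sum_add_distrib, ← Finset.sum_add_distrib]
    refine Finset.sum_le_sum fun p _ => ?_
    have hp := hF0 p.1 p.2
    have hz : ∀ r : ℝ, 0 < r → (0 : ℝ) ^ r = 0 := fun r hr => Real.zero_rpow hr.ne'
    by_cases hx : p.1 ∈ S <;> by_cases hy : p.2 ∈ S <;>
      simp [hx, hy, hz s hs0, hz (1 - s) (sub_pos.2 hs1)] <;>
      linarith [show F p.1 p.2 = A p.1 p.2 * (P p.1 ^ s * P p.2 ^ (1 - s)) from rfl]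
  linarith

section Typical

variable {V : Type*} [Fintype V] [DecidableEq V] (G : SimpleGraph V) [DecidableRel G.Adj]
  {d n : ℕ} {q : ℝ}

/-- A lower bound for the radius of a set of large weight under a product distribution. -/
theorem sum_edgeForm_sub_le_graphRadius (hG : G.IsRegularOfDegree d) (hq : 1 < q)
    {p : Fin n → V → ℝ} (hp : ∀ i, p i ∈ stdSimplex ℝ V) (S : Finset (Fin n → V))
    [Fintype (S : Set (Fin n → V))] {δ : ℝ} (hδ : ∑ x with x ∉ S, piWeight p x ≤ δ)
    (hδ1 : δ < 1) :
    ∑ i, edgeForm (1 / q) (G.adjMatrix ℝ) (p i) - n * d * (δ ^ (1 / q) + δ ^ (1 - 1 / q)) ≤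
      graphRadius q ((cartPow G n).induce (S : Set (Fin n → V))) := by
  have h0 := one_div_pos_of_one_lt hq
  have h1 := one_div_lt_one_of_one_lt hq
  have hA := prodGenerator_nonneg (adjMatrix_nonneg G) n
  have hrow := sum_prodGenerator (sum_adjMatrix G hG) n
  have hW := piWeight_mem hp
  set P : (Fin n → V) → ℝ := fun x => if x ∈ S then piWeight p x else 0 with hPdef
  have hP0 : ∀ x, 0 ≤ P x := fun x => by
    simp only [hPdef]; split_ifs
    · exact hW.1 x
    · exact le_rfl
  have hle := edgeForm_sub_le_restrict h0 h1 hA hrow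
    (fun y => by rw [← hrow y]; exact Finset.sum_congr rfl fun x _ =>
      prodGenerator_comm (adjMatrix_comm G) n x y) (by positivity) hW S hδ
  rw [edgeForm_piWeight _ _ hp] at hle
  have hsum : ∑ x, P x + ∑ x with x ∉ S, piWeight p x = 1 := by
    rw [← hW.2, Finset.sum_filter, ← Finset.sum_add_distrib]
    refine Finset.sum_congr rfl fun x _ => ?_
    by_cases hx : x ∈ S <;> simp [hPdef, hx]
  have hpos : 0 < ∑ x, P x := by linarith
  have hle1 : ∑ x, P x ≤ 1 := by
    have : 0 ≤ ∑ x with x ∉ S, piWeight p x := Finset.sum_nonneg fun x _ => hW.1 x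
    linarith
  have hmem : (fun x => (∑ z, P z)⁻¹ * P x) ∈ stdSimplex ℝ (Fin n → V) :=
    ⟨fun x => mul_nonneg (inv_nonneg.2 hpos.le) (hP0 x), by
      rw [← Finset.mul_sum, inv_mul_cancel₀ hpos.ne']⟩
  have hrad := edgeForm_le_graphRadius_cartPow G hq S hmem fun x hx => by simp [hPdef, hx]
  rw [edgeForm_smul _ (inv_nonneg.2 hpos.le) hP0] at hrad
  refine hle.trans (le_trans ?_ hrad)
  exact le_mul_of_one_le_left (edgeForm_nonneg hA hP0) ((one_le_inv₀ hpos).2 hle1)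

/-- The distributions within relative distance `ε` of `Q`. -/
def nearDist (ε : ℝ) (Q : V → ℝ) : Set (V → ℝ) :=
  {p | p ∈ stdSimplex ℝ V ∧ ∀ a, |p a - Q a| ≤ ε * Q a}

/-- The supremum of the edge form over the distributions within relative distance `ε` of `Q`. -/
noncomputable def nearSup (s : ℝ) (M : Matrix V V ℝ) (ε : ℝ) (Q : V → ℝ) : ℝ :=
  sSup (edgeForm s M '' nearDist ε Q)

theorem self_mem_nearDist {ε : ℝ} (hε : 0 ≤ ε) {Q : V → ℝ} (hQ : Q ∈ stdSimplex ℝ V) :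
    Q ∈ nearDist ε Q := ⟨hQ, fun a => by simpa using mul_nonneg hε (hQ.1 a)⟩

theorem le_nearSup {s : ℝ} (hs0 : 0 < s) (hs1 : s < 1) (M : Matrix V V ℝ) {ε : ℝ} {Q p : V → ℝ}
    (hp : p ∈ nearDist ε Q) : edgeForm s M p ≤ nearSup s M ε Q :=
  le_csSup ((bddAbove_edgeForm hs0 hs1 M).mono (Set.image_mono fun _ h => h.1)) ⟨p, hp, rfl⟩

/-- The supremum is approached by distributions at strictly smaller relative distance. -/
theorem exists_nearDist_of_lt {s : ℝ} (hs0 : 0 < s) (hs1 : s < 1) {M : Matrix V V ℝ}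
    (hM : ∀ x y, 0 ≤ M x y) {ε : ℝ} (hε : 0 < ε) {Q : V → ℝ} (hQ : Q ∈ stdSimplex ℝ V) {c : ℝ}
    (hc : c < nearSup s M ε Q) : ∃ ε' < ε, ∃ p ∈ nearDist ε' Q, c < edgeForm s M p := by
  obtain ⟨_, ⟨p, hp, rfl⟩, hcp⟩ :=
    exists_lt_of_lt_csSup (Set.Nonempty.image _ ⟨Q, self_mem_nearDist hε.le hQ⟩) hc
  have hlim : Tendsto (fun a : ℝ => (1 - a) * edgeForm s M p) (𝓝[>] 0)
      (𝓝 ((1 - 0) * edgeForm s M p)) :=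
    (Continuous.tendsto (by fun_prop) 0).mono_left nhdsWithin_le_nhds
  have hev := hlim.eventually (lt_mem_nhds (by simpa using hcp))
  have hlt1 : ∀ᶠ a : ℝ in 𝓝[>] 0, a < 1 := nhdsWithin_le_nhds (gt_mem_nhds one_pos)
  obtain ⟨a, hac, ha1, ha0⟩ := (hev.and (hlt1.and self_mem_nhdsWithin)).exists
  have ha0 : 0 < a := ha0
  refine ⟨(1 - a) * ε, by nlinarith, fun x => (1 - a) * p x + a * Q x,
    ⟨convex_stdSimplex ℝ V hp.1 hQ (sub_nonneg.2 ha1.le) ha0.le (by ring), fun x => ?_⟩, ?_⟩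
  · have : (1 - a) * p x + a * Q x - Q x = (1 - a) * (p x - Q x) := by ring
    rw [this, abs_mul, abs_of_pos (sub_pos.2 ha1), mul_assoc]
    exact mul_le_mul_of_nonneg_left (hp.2 x) (sub_nonneg.2 ha1.le)
  · have h1 := edgeForm_mix_le hs0 hs1 hM hp.1.1 hQ.1 (sub_nonneg.2 ha1.le) ha0.le
    have h2 := mul_nonneg ha0.le (edgeForm_nonneg (s := s) hM hQ.1)
    linarith

theorem sum_coordMarginal {P : (Fin n → V) → ℝ} (k : Fin n) : ∑ a, coordMarginal P k a = ∑ x, P x :=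
  Finset.sum_fiberwise Finset.univ (fun x : Fin n → V => x k) P

theorem sum_coordMarginal_block (P : (Fin n → V) → ℝ) (B : Finset (Fin n)) (a : V) :
    ∑ i ∈ B, coordMarginal P i a = ∑ x, P x * letterCount B x a := by
  simp only [coordMarginal, Finset.sum_filter, letterCount, Finset.card_filter]
  rw [Finset.sum_comm]
  refine Finset.sum_congr rfl fun x _ => ?_
  push_cast
  rw [Finset.mul_sum]
  exact Finset.sum_congr rfl fun i _ => by split_ifs <;> simp

/-- The marginals of a distribution on words that are typical on a block. -/
theorem sum_edgeForm_coordMarginal_le {s : ℝ} (hs0 : 0 < s) (hs1 : s < 1) {M : Matrix V V ℝ}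
    (hM : ∀ x y, 0 ≤ M x y) {ε : ℝ} {Q : V → ℝ} {P : (Fin n → V) → ℝ}
    (hP : P ∈ stdSimplex ℝ (Fin n → V)) (B : Finset (Fin n))
    (hPB : ∀ x, P x ≠ 0 → BlockTypical B ε Q x) :
    ∑ i ∈ B, edgeForm s M (coordMarginal P i) ≤ B.card * nearSup s M ε Q := by
  rcases B.eq_empty_or_nonempty with rfl | hB
  · simp
  have hc : (0 : ℝ) < B.card := by exact_mod_cast hB.card_pos
  have hm0 : ∀ i a, 0 ≤ coordMarginal P i a := fun i a => Finset.sum_nonneg fun x _ => hP.1 x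
  refine (sum_edgeForm_le hs0 hs1 hM B fun i _ => hm0 i).trans ?_
  set u : V → ℝ := fun a => ∑ i ∈ B, coordMarginal P i a with hu
  have hu0 : ∀ a, 0 ≤ u a := fun a => Finset.sum_nonneg fun i _ => hm0 i a
  have hnear : (fun a => (B.card : ℝ)⁻¹ * u a) ∈ nearDist ε Q := by
    refine ⟨⟨fun a => mul_nonneg (inv_nonneg.2 hc.le) (hu0 a), ?_⟩, fun a => ?_⟩
    · rw [← Finset.mul_sum, hu, Finset.sum_comm]
      simp only [sum_coordMarginal, hP.2, Finset.sum_const, nsmul_eq_mul, mul_one]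
      exact inv_mul_cancel₀ hc.ne'
    · have h1 : u a - B.card * Q a = ∑ x, P x * (letterCount B x a - B.card * Q a) := by
        simp only [hu, sum_coordMarginal_block, mul_sub, Finset.sum_sub_distrib,
          ← Finset.sum_mul, hP.2, one_mul]
      have h2 : |u a - B.card * Q a| ≤ ε * (B.card * Q a) := by
        rw [h1]
        refine (Finset.abs_sum_le_sum_abs _ _).trans ?_
        calc _ ≤ ∑ x, P x * (ε * (B.card * Q a)) := Finset.sum_le_sum fun x _ => by
              rw [abs_mul, abs_of_nonneg (hP.1 x)]
              by_cases hx : P x = 0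
              · simp [hx]
              · exact mul_le_mul_of_nonneg_left (hPB x hx a) (hP.1 x)
          _ = _ := by rw [← Finset.sum_mul, hP.2, one_mul]
      have h3 : (B.card : ℝ)⁻¹ * u a - Q a = (B.card : ℝ)⁻¹ * (u a - B.card * Q a) := by
        field_simp
      rw [h3, abs_mul, abs_of_pos (inv_pos.2 hc)]
      calc _ ≤ (B.card : ℝ)⁻¹ * (ε * (B.card * Q a)) :=
            mul_le_mul_of_nonneg_left h2 (inv_nonneg.2 hc.le)
        _ = ε * Q a := by field_simp
  have h4 := le_nearSup hs0 hs1 M hnear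
  rw [edgeForm_smul M (inv_nonneg.2 hc.le) hu0, inv_mul_le_iff₀ hc] at h4
  exact h4

theorem graphRadius_typicalProduct_le (hq : 1 < q) {ε : ℝ} {Q R : V → ℝ} {k : ℕ}
    (hne : (typicalProduct ε Q R n k).Nonempty)
    [Fintype (typicalProduct ε Q R n k : Set (Fin n → V))] :
    graphRadius q ((cartPow G n).induce (typicalProduct ε Q R n k : Set (Fin n → V))) ≤
      (Finset.univ.filter fun i : Fin n => i.val < k).card *
          nearSup (1 / q) (G.adjMatrix ℝ) ε Q +
        (Finset.univ.filter fun i : Fin n => ¬ i.val < k).card *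
          nearSup (1 / q) (G.adjMatrix ℝ) ε R := by
  have h0 := one_div_pos_of_one_lt hq
  have h1 := one_div_lt_one_of_one_lt hq
  have hM := adjMatrix_nonneg G
  refine graphRadius_cartPow_le G hq hne fun P hP hPS => ?_
  have htyp : ∀ x, P x ≠ 0 → x ∈ typicalProduct ε Q R n k := fun x hx => by
    by_contra h; exact hx (hPS x h)
  refine (edgeForm_le_sum_coordMarginal h0 h1 hM hP.1).trans ?_
  rw [← Finset.sum_filter_add_sum_filter_not Finset.univ fun i : Fin n => i.val < k]
  exact add_le_add
    (sum_edgeForm_coordMarginal_le h0 h1 hM hP _ fun x hx =>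
      ((mem_typicalProduct_iff ε Q R k x).1 (htyp x hx)).1)
    (sum_edgeForm_coordMarginal_le h0 h1 hM hP _ fun x hx =>
      ((mem_typicalProduct_iff ε Q R k x).1 (htyp x hx)).2)

end Typical

/-! ### The asymptotic radius of a product of two typical sets -/

section Asymptotic

variable {V : Type*} [Fintype V] [DecidableEq V] {G : SimpleGraph V} [DecidableRel G.Adj]
  {d : ℕ} {q : ℝ}

theorem card_filter_val_lt_of_le {n k : ℕ} (hk : k ≤ n) :
    (Finset.univ.filter fun i : Fin n => i.val < k).card = k := by
  rw [Fin.card_filter_val_lt, min_eq_right hk]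

theorem card_filter_not_val_lt_of_le {n k : ℕ} (hk : k ≤ n) :
    ((Finset.univ.filter fun i : Fin n => ¬ i.val < k).card : ℝ) = n - k := by
  have := Finset.card_filter_add_card_filter_not (s := (Finset.univ : Finset (Fin n)))
    (fun i : Fin n => i.val < k)
  rw [card_filter_val_lt_of_le hk, Finset.card_univ, Fintype.card_fin] at this
  rw [eq_sub_iff_add_eq', ← Nat.cast_add, this]

theorem sum_not_typicalProduct_le {n k : ℕ} (hk0 : 0 < k) (hkn : k < n) {Q R p r : V → ℝ}
    (hQ : Q ∈ stdSimplex ℝ V) (hR : R ∈ stdSimplex ℝ V) {ε ε₁ ε₂ : ℝ} (h₁ : ε₁ < ε) (h₂ : ε₂ < ε)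
    (hp : p ∈ nearDist ε₁ Q) (hr : r ∈ nearDist ε₂ R) :
    ∑ x with x ∉ typicalProduct ε Q R n k,
        piWeight (fun i : Fin n => if i.val < k then p else r) x ≤
      (∑ a, 1 / ((ε - ε₁) * Q a) ^ 2) / k + (∑ a, 1 / ((ε - ε₂) * R a) ^ 2) / (n - k) := by
  classical
  set w : Fin n → V → ℝ := fun i : Fin n => if i.val < k then p else r with hw
  have hwm : ∀ i, w i ∈ stdSimplex ℝ V := fun i => by
    simp only [hw]; split_ifs
    · exact hp.1
    · exact hr.1
  have hB : (Finset.univ.filter fun i : Fin n => i.val < k).Nonempty := by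
    rw [← Finset.card_pos, card_filter_val_lt_of_le hkn.le]; exact hk0
  have hB' : (Finset.univ.filter fun i : Fin n => ¬ i.val < k).Nonempty := by
    rw [← Finset.card_pos, ← Nat.cast_pos (α := ℝ), card_filter_not_val_lt_of_le hkn.le]
    exact sub_pos.2 (by exact_mod_cast hkn)
  have e1 := sum_not_blockTypical_le hwm hB (Q := Q) (Q' := p) (fun i hi => by
    simp only [hw, if_pos (Finset.mem_filter.1 hi).2]) hQ hp.1 h₁ hp.2
  have e2 := sum_not_blockTypical_le hwm hB' (Q := R) (Q' := r) (fun i hi => by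
    simp only [hw, if_neg (Finset.mem_filter.1 hi).2]) hR hr.1 h₂ hr.2
  rw [card_filter_val_lt_of_le hkn.le] at e1
  rw [card_filter_not_val_lt_of_le hkn.le] at e2
  refine le_trans ?_ (add_le_add e1 e2)
  simp only [Finset.sum_filter]
  rw [← Finset.sum_add_distrib]
  refine Finset.sum_le_sum fun x _ => ?_
  have hx0 := (piWeight_mem hwm).1 x
  by_cases hx : x ∈ typicalProduct ε Q R n k
  · rw [if_neg (not_not.2 hx)]
    refine add_nonneg ?_ ?_ <;> split_ifs <;> first | exact le_rfl | exact hx0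
  · rw [if_pos hx]
    rw [mem_typicalProduct_iff, not_and_or] at hx
    rcases hx with hx | hx
    · rw [if_pos hx]
      refine le_add_of_nonneg_right ?_
      split_ifs <;> first | exact le_rfl | exact hx0
    · rw [if_pos hx]
      refine le_add_of_nonneg_left ?_
      split_ifs <;> first | exact le_rfl | exact hx0

variable {lam : ℝ}

theorem tendsto_floor_div (h0 : 0 < lam) :
    Tendsto (fun n : ℕ => (⌊lam * (n : ℝ)⌋₊ : ℝ) / n) atTop (𝓝 lam) :=
  (tendsto_nat_floor_mul_div_atTop h0.le).comp tendsto_natCast_atTop_atTop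

theorem tendsto_floor (h0 : 0 < lam) :
    Tendsto (fun n : ℕ => ⌊lam * (n : ℝ)⌋₊) atTop atTop :=
  tendsto_nat_floor_atTop.comp (tendsto_natCast_atTop_atTop.const_mul_atTop h0)

theorem tendsto_sub_floor (h0 : 0 < lam) (h1 : lam < 1) :
    Tendsto (fun n : ℕ => (n : ℝ) - ⌊lam * (n : ℝ)⌋₊) atTop atTop := by
  refine tendsto_atTop_mono (fun n => ?_)
    ((tendsto_natCast_atTop_atTop (R := ℝ)).const_mul_atTop (sub_pos.2 h1))
  have := Nat.floor_le (a := lam * (n : ℝ)) (by positivity)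
  linarith

theorem eventually_floor (h0 : 0 < lam) (h1 : lam < 1) :
    ∀ᶠ n : ℕ in atTop, 0 < ⌊lam * (n : ℝ)⌋₊ ∧ ⌊lam * (n : ℝ)⌋₊ < n := by
  filter_upwards [(tendsto_floor h0).eventually_gt_atTop 0,
    (tendsto_sub_floor h0 h1).eventually_gt_atTop 0] with n hn hn'
  exact ⟨hn, by exact_mod_cast sub_pos.1 hn'⟩

theorem tendsto_mix_floor (h0 : 0 < lam) (a b : ℝ) :
    Tendsto (fun n : ℕ => 1 / (n : ℝ) * (⌊lam * (n : ℝ)⌋₊ * a + (n - ⌊lam * (n : ℝ)⌋₊) * b)) atTop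
      (𝓝 (lam * a + (1 - lam) * b)) := by
  have h := ((tendsto_floor_div h0).mul_const a).add
    (((tendsto_floor_div h0).const_sub 1).mul_const b)
  refine h.congr' ?_
  filter_upwards [eventually_gt_atTop 0] with n hn
  have : (n : ℝ) ≠ 0 := by exact_mod_cast hn.ne'
  field_simp

theorem exists_tendsto_zero_radius_bound (hG : G.IsRegularOfDegree d) (hq : 1 < q)
    {Q R p r : V → ℝ} (hQ : Q ∈ stdSimplex ℝ V) (hR : R ∈ stdSimplex ℝ V) (h0 : 0 < lam)
    (h1 : lam < 1) {ε ε₁ ε₂ : ℝ} (h₁ : ε₁ < ε) (h₂ : ε₂ < ε)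
    (hp : p ∈ nearDist ε₁ Q) (hr : r ∈ nearDist ε₂ R) :
    (∀ᶠ n : ℕ in atTop, (typicalProduct ε Q R n ⌊lam * (n : ℝ)⌋₊).Nonempty) ∧
    ∃ e : ℕ → ℝ, Tendsto e atTop (𝓝 0) ∧ ∀ᶠ n : ℕ in atTop,
      1 / (n : ℝ) * (⌊lam * (n : ℝ)⌋₊ * edgeForm (1 / q) (G.adjMatrix ℝ) p +
          (n - ⌊lam * (n : ℝ)⌋₊) * edgeForm (1 / q) (G.adjMatrix ℝ) r) - e n ≤
        1 / (n : ℝ) * graphRadius q ((cartPow G n).induce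
          (typicalProduct ε Q R n ⌊lam * (n : ℝ)⌋₊ : Set (Fin n → V))) := by
  have hs0 := one_div_pos_of_one_lt hq
  have hs1 := one_div_lt_one_of_one_lt hq
  set δ : ℕ → ℝ := fun n => (∑ a, 1 / ((ε - ε₁) * Q a) ^ 2) / (⌊lam * (n : ℝ)⌋₊ : ℝ) +
    (∑ a, 1 / ((ε - ε₂) * R a) ^ 2) / ((n : ℝ) - ⌊lam * (n : ℝ)⌋₊) with hδdef
  have hδ : Tendsto δ atTop (𝓝 0) := by
    have := ((tendsto_natCast_atTop_atTop.comp (tendsto_floor h0)).const_div_atTop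
      (∑ a, 1 / ((ε - ε₁) * Q a) ^ 2)).add
      ((tendsto_sub_floor h0 h1).const_div_atTop (∑ a, 1 / ((ε - ε₂) * R a) ^ 2))
    rw [add_zero] at this
    exact this
  have hw : ∀ n : ℕ, ∀ i : Fin n,
      (if i.val < ⌊lam * (n : ℝ)⌋₊ then p else r) ∈ stdSimplex ℝ V := fun n i => by
    split_ifs
    · exact hp.1
    · exact hr.1
  constructor
  · filter_upwards [eventually_floor h0 h1, hδ.eventually (gt_mem_nhds one_pos)] with n hn hδn
    have hle := sum_not_typicalProduct_le hn.1 hn.2 hQ hR h₁ h₂ hp hr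
    rw [Finset.nonempty_iff_ne_empty]
    intro hemp
    rw [hemp] at hle
    simp only [Finset.notMem_empty, not_false_eq_true, Finset.filter_true,
      (piWeight_mem (hw n)).2] at hle
    exact absurd (hle.trans_lt hδn) (lt_irrefl _)
  · refine ⟨fun n => d * (δ n ^ (1 / q) + δ n ^ (1 - 1 / q)), ?_, ?_⟩
    · have e1 := hδ.rpow_const (p := 1 / q) (Or.inr hs0.le)
      have e2 := hδ.rpow_const (p := 1 - 1 / q) (Or.inr (sub_pos.2 hs1).le)
      rw [Real.zero_rpow hs0.ne'] at e1
      rw [Real.zero_rpow (sub_pos.2 hs1).ne'] at e2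
      simpa using (e1.add e2).const_mul (d : ℝ)
    · filter_upwards [eventually_floor h0 h1, hδ.eventually (gt_mem_nhds one_pos),
        eventually_gt_atTop 0] with n hn hδn hn0
      have hn' : (0 : ℝ) < n := by exact_mod_cast hn0
      have hle := sum_not_typicalProduct_le hn.1 hn.2 hQ hR h₁ h₂ hp hr
      have hrad := sum_edgeForm_sub_le_graphRadius G hG hq (hw n) _ (δ := δ n) hle hδn
      have hsum : ∑ i : Fin n, edgeForm (1 / q) (G.adjMatrix ℝ)
          (if i.val < ⌊lam * (n : ℝ)⌋₊ then p else r) =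
          ⌊lam * (n : ℝ)⌋₊ * edgeForm (1 / q) (G.adjMatrix ℝ) p +
          (n - ⌊lam * (n : ℝ)⌋₊) * edgeForm (1 / q) (G.adjMatrix ℝ) r := by
        rw [← Finset.sum_filter_add_sum_filter_not Finset.univ
          fun i : Fin n => i.val < ⌊lam * (n : ℝ)⌋₊,
          Finset.sum_congr rfl fun i hi => by rw [if_pos (Finset.mem_filter.1 hi).2],
          Finset.sum_const, nsmul_eq_mul, card_filter_val_lt_of_le hn.2.le,
          Finset.sum_congr rfl fun i hi => by rw [if_neg (Finset.mem_filter.1 hi).2],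
          Finset.sum_const, nsmul_eq_mul, card_filter_not_val_lt_of_le hn.2.le]
      rw [hsum] at hrad
      have := mul_le_mul_of_nonneg_left hrad (by positivity : 0 ≤ 1 / (n : ℝ))
      refine le_trans (le_of_eq ?_) this
      rw [mul_sub]
      congr 1
      field_simp

theorem tendsto_graphRadius_typicalProduct (hG : G.IsRegularOfDegree d) (hq : 1 < q)
    {Q R : V → ℝ} (hQ : Q ∈ stdSimplex ℝ V) (hR : R ∈ stdSimplex ℝ V) (h0 : 0 < lam)
    (h1 : lam < 1) {ε : ℝ} (hε : 0 < ε) :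
    (∀ᶠ n : ℕ in atTop, (typicalProduct ε Q R n ⌊lam * (n : ℝ)⌋₊).Nonempty) ∧
    Tendsto (fun n : ℕ => 1 / (n : ℝ) * graphRadius q ((cartPow G n).induce
        (typicalProduct ε Q R n ⌊lam * (n : ℝ)⌋₊ : Set (Fin n → V)))) atTop
      (𝓝 (lam * nearSup (1 / q) (G.adjMatrix ℝ) ε Q +
        (1 - lam) * nearSup (1 / q) (G.adjMatrix ℝ) ε R)) := by
  have hs0 := one_div_pos_of_one_lt hq
  have hs1 := one_div_lt_one_of_one_lt hq
  have hM := adjMatrix_nonneg G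
  have hne := (exists_tendsto_zero_radius_bound hG hq hQ hR h0 h1 hε hε
    (self_mem_nearDist le_rfl hQ) (self_mem_nearDist le_rfl hR)).1
  refine ⟨hne, ?_⟩
  rw [tendsto_order]
  constructor
  · intro c hc
    set a := nearSup (1 / q) (G.adjMatrix ℝ) ε Q
    set b := nearSup (1 / q) (G.adjMatrix ℝ) ε R
    set η := (lam * a + (1 - lam) * b - c) / 2 with hη
    obtain ⟨ε₁, hε₁, p, hp, hpa⟩ := exists_nearDist_of_lt hs0 hs1 hM hε hQ
      (show a - η < a by linarith)
    obtain ⟨ε₂, hε₂, r, hr, hrb⟩ := exists_nearDist_of_lt hs0 hs1 hM hε hR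
      (show b - η < b by linarith)
    obtain ⟨-, e, he, hle⟩ := exists_tendsto_zero_radius_bound hG hq hQ hR h0 h1 hε₁ hε₂ hp hr
    have hlim := (tendsto_mix_floor h0 (edgeForm (1 / q) (G.adjMatrix ℝ) p)
      (edgeForm (1 / q) (G.adjMatrix ℝ) r)).sub he
    have hlt : c < lam * edgeForm (1 / q) (G.adjMatrix ℝ) p +
        (1 - lam) * edgeForm (1 / q) (G.adjMatrix ℝ) r - 0 := by
      have e1 := mul_le_mul_of_nonneg_left hpa.le h0.le
      have e2 := mul_le_mul_of_nonneg_left hrb.le (sub_nonneg.2 h1.le)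
      linarith
    filter_upwards [hle, hlim.eventually (lt_mem_nhds hlt)] with n hn hn'
    exact hn'.trans_le hn
  · intro c hc
    filter_upwards [hne, (tendsto_mix_floor h0 _ _).eventually (gt_mem_nhds hc),
      eventually_floor h0 h1] with n hn hn' hfl
    refine lt_of_le_of_lt (mul_le_mul_of_nonneg_left ?_ (by positivity)) hn'
    have := graphRadius_typicalProduct_le G hq hn
    rwa [card_filter_val_lt_of_le hfl.2.le, card_filter_not_val_lt_of_le hfl.2.le] at this

/-! ### Near-optimal pairs of distributions -/

theorem exists_near_optimal_pair [Nonempty V] {s : ℝ} {M : Matrix V V ℝ}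
    (hM : ∀ x y, 0 ≤ M x y) {β η : ℝ} (hβ : 0 ≤ β) (hη : 0 < η) :
    ∃ Q ∈ stdSimplex ℝ V, ∃ R ∈ stdSimplex ℝ V, ∃ a : ℝ, 0 < a ∧ a < 1 ∧
      edgeEnvelope s M β - η ≤ a * edgeForm s M Q + (1 - a) * edgeForm s M R ∧
      (a * shannonEntropy Q + (1 - a) * shannonEntropy R < β ∨
        shannonEntropy Q = 0 ∧ shannonEntropy R = 0) := by
  have hlt : edgeEnvelope s M β - η < edgeEnvelope s M β := by linarith
  rcases hβ.eq_or_lt with rfl | hβ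
  · obtain ⟨z, hz, hz0, hzc⟩ := exists_lt_of_lt_edgeEnvelope hM le_rfl hlt
    obtain ⟨Q, hQ, R, hR, a, ha0, ha1, h1, h2⟩ := exists_pair_of_mem_entropyEdgeHull hz
    refine ⟨Q, hQ, R, hR, a, ha0, ha1, hzc.le.trans h2, Or.inr ?_⟩
    have e1 := shannonEntropy_nonneg hQ
    have e2 := shannonEntropy_nonneg hR
    have e3 := mul_nonneg ha0.le e1
    have e4 := mul_nonneg (sub_pos.2 ha1).le e2
    have e5 : a * shannonEntropy Q = 0 := by linarith
    have e6 : (1 - a) * shannonEntropy R = 0 := by linarith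
    exact ⟨(mul_eq_zero.1 e5).resolve_left ha0.ne',
      (mul_eq_zero.1 e6).resolve_left (sub_pos.2 ha1).ne'⟩
  · obtain ⟨z, hz, hz0, hzc⟩ := exists_fst_lt_of_lt_edgeEnvelope hM hβ hlt
    obtain ⟨Q, hQ, R, hR, a, ha0, ha1, h1, h2⟩ := exists_pair_of_mem_entropyEdgeHull hz
    exact ⟨Q, hQ, R, hR, a, ha0, ha1, hzc.le.trans h2, Or.inl (h1 ▸ hz0)⟩

theorem eventually_card_typicalProduct_le {Q R : V → ℝ} (hQ : Q ∈ stdSimplex ℝ V)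
    (hR : R ∈ stdSimplex ℝ V) (h0 : 0 < lam) (h1 : lam < 1) {β : ℝ} {m : ℕ → ℕ}
    (hm : ∀ n, 1 ≤ n → 1 ≤ m n)
    (hlim : Tendsto (fun n : ℕ => 1 / (n : ℝ) * Real.log (m n)) atTop (𝓝 β))
    (hent : lam * shannonEntropy Q + (1 - lam) * shannonEntropy R < β ∨
      shannonEntropy Q = 0 ∧ shannonEntropy R = 0) :
    ∃ ε₀ : ℝ, 0 < ε₀ ∧ ∀ ε : ℝ, 0 < ε → ε < ε₀ → ∀ᶠ n : ℕ in atTop,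
      (typicalProduct ε Q R n ⌊lam * (n : ℝ)⌋₊).card ≤ m n := by
  rcases hent with hent | ⟨hHQ, hHR⟩
  · set h := lam * shannonEntropy Q + (1 - lam) * shannonEntropy R with hh
    have hpos : 0 ≤ h := add_nonneg (mul_nonneg h0.le (shannonEntropy_nonneg hQ))
      (mul_nonneg (sub_pos.2 h1).le (shannonEntropy_nonneg hR))
    refine ⟨(β - h) / (h + 1), div_pos (by linarith) (by linarith), fun ε hε hε' => ?_⟩
    rw [lt_div_iff₀ (by linarith)] at hε'
    have hlt : (1 + ε) * h < β := by linarith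
    have hconv := (tendsto_mix_floor h0 (shannonEntropy Q) (shannonEntropy R)).const_mul (1 + ε)
    filter_upwards [hconv.eventually_lt hlim hlt, eventually_floor h0 h1,
      eventually_ge_atTop 1] with n hn hfl hn1
    have hn' : (0 : ℝ) < n := by exact_mod_cast hn1
    have hm' : (0 : ℝ) < m n := by exact_mod_cast hm n hn1
    have hcard := card_typicalProduct_le (n := n) (ε := ε) hQ hR ⌊lam * (n : ℝ)⌋₊
    rw [card_filter_val_lt_of_le hfl.2.le, card_filter_not_val_lt_of_le hfl.2.le] at hcard
    rw [mul_left_comm, mul_lt_mul_iff_right₀ (by positivity)] at hn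
    have : ((typicalProduct ε Q R n ⌊lam * (n : ℝ)⌋₊).card : ℝ) ≤ m n := by
      refine hcard.trans ?_
      rw [← Real.exp_log hm', Real.exp_le_exp]
      exact hn.le
    exact_mod_cast this
  · refine ⟨1, one_pos, fun ε _ _ => ?_⟩
    filter_upwards [eventually_ge_atTop 1] with n hn1
    have hcard := card_typicalProduct_le (n := n) (ε := ε) hQ hR ⌊lam * (n : ℝ)⌋₊
    rw [hHQ, hHR] at hcard
    have : (typicalProduct ε Q R n ⌊lam * (n : ℝ)⌋₊).card ≤ 1 := by
      have h : ((typicalProduct ε Q R n ⌊lam * (n : ℝ)⌋₊).card : ℝ) ≤ 1 := by simpa using hcard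
      exact_mod_cast h
    exact this.trans (hm n hn1)

theorem exists_typicalProduct_near_optimal [Nonempty V] (hG : G.IsRegularOfDegree d) (hq : 1 < q)
    {β : ℝ} (hβ : 0 ≤ β) {m : ℕ → ℕ} (hm : ∀ n, 1 ≤ n → 1 ≤ m n)
    (hlim : Tendsto (fun n : ℕ => 1 / (n : ℝ) * Real.log (m n)) atTop (𝓝 β)) {η : ℝ}
    (hη : 0 < η) :
    ∃ Q ∈ stdSimplex ℝ V, ∃ R ∈ stdSimplex ℝ V, ∃ lam ∈ Set.Icc (0 : ℝ) 1,
      ∃ ε₀ : ℝ, 0 < ε₀ ∧ ∀ ε : ℝ, 0 < ε → ε < ε₀ →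
        (∀ᶠ n : ℕ in atTop, (typicalProduct ε Q R n ⌊lam * (n : ℝ)⌋₊).Nonempty ∧
          (typicalProduct ε Q R n ⌊lam * (n : ℝ)⌋₊).card ≤ m n) ∧
        ∃ ℓ : ℝ,
          Tendsto (fun n : ℕ => 1 / (n : ℝ) * graphRadius q ((cartPow G n).induce
            (typicalProduct ε Q R n ⌊lam * (n : ℝ)⌋₊ : Set (Fin n → V)))) atTop (𝓝 ℓ) ∧
          ℓ ≤ edgeEnvelope (1 / q) (G.adjMatrix ℝ) β ∧
          edgeEnvelope (1 / q) (G.adjMatrix ℝ) β ≤ ℓ + η := by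
  have hs0 := one_div_pos_of_one_lt hq
  have hs1 := one_div_lt_one_of_one_lt hq
  have hM := adjMatrix_nonneg G
  obtain ⟨Q, hQ, R, hR, lam, h0, h1, hval, hent⟩ :=
    exists_near_optimal_pair (s := 1 / q) hM hβ hη
  obtain ⟨ε₀, hε₀, hcard⟩ := eventually_card_typicalProduct_le hQ hR h0 h1 hm hlim hent
  refine ⟨Q, hQ, R, hR, lam, ⟨h0.le, h1.le⟩, ε₀, hε₀, fun ε hε hε' => ?_⟩
  obtain ⟨hne, hT⟩ := tendsto_graphRadius_typicalProduct hG hq hQ hR h0 h1 hε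
  refine ⟨hne.and (hcard ε hε hε'), _, hT, ?_, ?_⟩
  · refine le_of_tendsto_of_tendsto hT
      (tendsto_edgeEnvelope hs0 hs1 hM hβ hlim (Eventually.of_forall fun n => ?_)) ?_
    · exact mul_nonneg (by positivity) (Real.log_natCast_nonneg _)
    · filter_upwards [hne, hcard ε hε hε', eventually_ge_atTop 1] with n hn hc hn1
      exact (mul_le_mul_of_nonneg_left (graphRadius_le_faberKrahn G hn hc) (by positivity)).trans
        (faberKrahn_le_edgeEnvelope G hq hn1 (hm n hn1))
  · have e1 := mul_le_mul_of_nonneg_left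
      (le_nearSup hs0 hs1 (G.adjMatrix ℝ) (self_mem_nearDist hε.le hQ)) h0.le
    have e2 := mul_le_mul_of_nonneg_left
      (le_nearSup hs0 hs1 (G.adjMatrix ℝ) (self_mem_nearDist hε.le hR)) (sub_pos.2 h1).le
    linarith

theorem tendsto_faberKrahn [Nonempty V] (hG : G.IsRegularOfDegree d) (hq : 1 < q)
    {β : ℝ} (hβ : 0 ≤ β) {m : ℕ → ℕ} (hm : ∀ n, 1 ≤ n → 1 ≤ m n)
    (hlim : Tendsto (fun n : ℕ => 1 / (n : ℝ) * Real.log (m n)) atTop (𝓝 β)) :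
    Tendsto (fun n : ℕ => 1 / (n : ℝ) * faberKrahn G q n (m n)) atTop
      (𝓝 (edgeEnvelope (1 / q) (G.adjMatrix ℝ) β)) := by
  have hs0 := one_div_pos_of_one_lt hq
  have hs1 := one_div_lt_one_of_one_lt hq
  have hM := adjMatrix_nonneg G
  rw [tendsto_order]
  constructor
  · intro c hc
    obtain ⟨Q, -, R, -, lam, -, ε₀, hε₀, h⟩ :=
      exists_typicalProduct_near_optimal hG hq hβ hm hlim (half_pos (sub_pos.2 hc))
    obtain ⟨hev, ℓ, hℓ, -, hℓ'⟩ := h (ε₀ / 2) (half_pos hε₀) (half_lt_self hε₀)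
    filter_upwards [hev, hℓ.eventually (lt_mem_nhds (show c < ℓ by linarith))] with n hn hn'
    exact hn'.trans_le (mul_le_mul_of_nonneg_left (graphRadius_le_faberKrahn G hn.1 hn.2)
      (by positivity))
  · intro c hc
    have hu := tendsto_edgeEnvelope hs0 hs1 hM hβ hlim
      (Eventually.of_forall fun n => mul_nonneg (by positivity) (Real.log_natCast_nonneg _))
    filter_upwards [hu.eventually (gt_mem_nhds hc), eventually_ge_atTop 1] with n hn hn1
    exact (faberKrahn_le_edgeEnvelope G hq hn1 (hm n hn1)).trans_lt hn

end Asymptotic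

theorem log_card_sub_mem {N n m : ℕ} (hn : 1 ≤ n) (hm : 1 ≤ m) (hmN : m ≤ N ^ n) :
    0 ≤ Real.log N - 1 / (n : ℝ) * Real.log m ∧
      Real.log N - 1 / (n : ℝ) * Real.log m ≤ Real.log N := by
  have hn' : (0 : ℝ) < n := by exact_mod_cast hn
  have hm' : (0 : ℝ) < m := by exact_mod_cast hm
  constructor
  · have h : Real.log m ≤ n * Real.log N := by
      rw [← Real.log_pow]
      exact Real.log_le_log hm' (by exact_mod_cast hmN)
    rw [sub_nonneg, one_div_mul_eq_div, div_le_iff₀' hn']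
    exact h
  · have := mul_nonneg (one_div_pos.2 hn').le (Real.log_natCast_nonneg m)
    linarith

theorem coe_sub_coe_sub (a b : ℝ) : (a : EReal) - ((a - b : ℝ) : EReal) = (b : EReal) := by
  rw [← EReal.coe_sub, sub_sub_cancel]

theorem theorem5 {V : Type*} [Fintype V] [DecidableEq V] (G : SimpleGraph V)
    [DecidableRel G.Adj] (d : ℕ) (hG : G.IsRegularOfDegree d) (q : ℝ) (hq : 1 < q) :
    -- the identity and the bound for every `n ≥ 1` and `1 ≤ m ≤ |V|^n`
    (∀ n m : ℕ, 1 ≤ n → 1 ≤ m → m ≤ Fintype.card V ^ n →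
      ((1 / (n : ℝ) * faberKrahn G q n m : ℝ) : EReal) =
          ((d : ℝ) : EReal) -
            graphXiZero G d q n (Real.log (Fintype.card V) - 1 / (n : ℝ) * Real.log m) ∧
      ((d : ℝ) : EReal) -
            graphXiZero G d q n (Real.log (Fintype.card V) - 1 / (n : ℝ) * Real.log m) ≤
          ((d : ℝ) : EReal) -
            graphXiConv G d q (Real.log (Fintype.card V) - 1 / (n : ℝ) * Real.log m)) ∧
    -- asymptotic tightness for `m = e^{nβ + o(n)}`
    (∀ β : ℝ, 0 ≤ β → β < Real.log (Fintype.card V) →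
      ∀ m : ℕ → ℕ, (∀ n, 1 ≤ n → 1 ≤ m n ∧ m n ≤ Fintype.card V ^ n) →
      ((fun n : ℕ => Real.log (m n) - (n : ℝ) * β) =o[atTop] fun n : ℕ => (n : ℝ)) →
      Tendsto (fun n : ℕ => ((1 / (n : ℝ) * faberKrahn G q n (m n) : ℝ) : EReal)) atTop
        (𝓝 (((d : ℝ) : EReal) - graphXiConv G d q (Real.log (Fintype.card V) - β))) ∧
      Tendsto (fun n : ℕ => ((d : ℝ) : EReal) -
          graphXiConv G d q (Real.log (Fintype.card V) - 1 / (n : ℝ) * Real.log (m n))) atTop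
        (𝓝 (((d : ℝ) : EReal) - graphXiConv G d q (Real.log (Fintype.card V) - β))) ∧
      -- products of at most two typical sets come arbitrarily close to the bound
      ∀ η : ℝ, 0 < η →
        ∃ Q ∈ stdSimplex ℝ V, ∃ R ∈ stdSimplex ℝ V, ∃ lam ∈ Set.Icc (0 : ℝ) 1,
          ∃ ε₀ : ℝ, 0 < ε₀ ∧ ∀ ε : ℝ, 0 < ε → ε < ε₀ →
            (∀ᶠ n : ℕ in atTop, (typicalProduct ε Q R n ⌊lam * (n : ℝ)⌋₊).Nonempty ∧
              (typicalProduct ε Q R n ⌊lam * (n : ℝ)⌋₊).card ≤ m n) ∧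
            ∃ ℓ : ℝ,
              Tendsto (fun n : ℕ => 1 / (n : ℝ) * graphRadius q ((cartPow G n).induce
                (typicalProduct ε Q R n ⌊lam * (n : ℝ)⌋₊ : Set (Fin n → V)))) atTop (𝓝 ℓ) ∧
              (ℓ : EReal) ≤
                ((d : ℝ) : EReal) - graphXiConv G d q (Real.log (Fintype.card V) - β) ∧
              ((d : ℝ) : EReal) - graphXiConv G d q (Real.log (Fintype.card V) - β) ≤
                ((ℓ + η : ℝ) : EReal)) := by
  rcases isEmpty_or_nonempty V with hV | hV
  · refine ⟨fun n m hn hm hmn => ?_, fun β hβ hβ' => ?_⟩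
    · rw [Fintype.card_eq_zero, zero_pow (by omega)] at hmn
      omega
    · rw [Fintype.card_eq_zero, Nat.cast_zero, Real.log_zero] at hβ'
      exact absurd hβ' hβ.not_gt
  have hs0 := one_div_pos_of_one_lt hq
  have hs1 := one_div_lt_one_of_one_lt hq
  have hM := adjMatrix_nonneg G
  refine ⟨fun n m hn hm hmn => ?_, fun β hβ hβ' m hm ho => ?_⟩
  · obtain ⟨hα0, hα1⟩ := log_card_sub_mem hn hm hmn
    rw [graphXiZero_eq G d hq hn hm, graphXiConv_eq G hG hq hα0 hα1, coe_sub_coe_sub,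
      coe_sub_coe_sub, sub_sub_cancel]
    exact ⟨rfl, EReal.coe_le_coe_iff.2 (faberKrahn_le_edgeEnvelope G hq hn hm)⟩
  · have hm1 : ∀ n, 1 ≤ n → 1 ≤ m n := fun n hn => (hm n hn).1
    have hlim : Tendsto (fun n : ℕ => 1 / (n : ℝ) * Real.log (m n)) atTop (𝓝 β) := by
      have h := ho.tendsto_div_nhds_zero.add_const β
      rw [zero_add] at h
      refine h.congr' ?_
      filter_upwards [eventually_gt_atTop 0] with n hn
      have : (n : ℝ) ≠ 0 := by exact_mod_cast hn.ne'
      field_simp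
      ring
    rw [graphXiConv_eq G hG hq (sub_nonneg.2 hβ'.le) (by linarith), coe_sub_coe_sub,
      sub_sub_cancel]
    refine ⟨?_, ?_, fun η hη => ?_⟩
    · exact (continuous_coe_real_ereal.tendsto _).comp (tendsto_faberKrahn hG hq hβ hm1 hlim)
    · have hu := tendsto_edgeEnvelope hs0 hs1 hM hβ hlim
        (Eventually.of_forall fun n => mul_nonneg (by positivity) (Real.log_natCast_nonneg _))
      refine ((continuous_coe_real_ereal.tendsto _).comp hu).congr' ?_
      filter_upwards [eventually_ge_atTop 1] with n hn
      obtain ⟨hα0, hα1⟩ := log_card_sub_mem hn (hm n hn).1 (hm n hn).2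
      rw [graphXiConv_eq G hG hq hα0 hα1, coe_sub_coe_sub, sub_sub_cancel]
      rfl
    · obtain ⟨Q, hQ, R, hR, lam, hlam, ε₀, hε₀, h⟩ :=
        exists_typicalProduct_near_optimal hG hq hβ hm1 hlim hη
      refine ⟨Q, hQ, R, hR, lam, hlam, ε₀, hε₀, fun ε hε hε' => ?_⟩
      obtain ⟨hev, ℓ, hℓ, hle, hle'⟩ := h ε hε hε'
      exact ⟨hev, ℓ, hℓ, EReal.coe_le_coe_iff.2 hle, EReal.coe_le_coe_iff.2 hle'⟩
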